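/- **Theorem 5.11.** Let $R$ be a two-sided noetherian ring and let $\mathcal K(\operatorname{proj} R)$ be the homotopy category of (unbounded) cochain complexes of finitely generated projective right $R$-modules. For $X\in\mathcal K(\operatorname{proj} R)$ and $i\in\mathbb Z$ let $C^i(X)=\operatorname{Coker}(X^{i-1}\to X^i)$, and let $X^\ast=\operatorname{Hom}_R(X,R)\in\mathcal K(\operatorname{proj} R^{\mathrm{op}})$ be the $R$-dual complex, with $(X^\ast)^i=(X^{-i})^\ast$. The object $X$ is called *Gorenstein projective* if $\operatorname{Ext}^j_R(C^i(X),R)=0$ and $\operatorname{Ext}^j_{R^{\mathrm{op}}}(C^i(X^\ast),R)=0$ for all $i\in\mathbb Z$ and all $j>0$. A triangle $X\to Y\to Z\to X[1]$ is called *cohomologically ghost* if $0\to H^i(X)\to H^i(Y)\to H^i(Z)\to 0$ is exact for every $i\in\mathbb Z$. Let $\operatorname{Add} R$ be the smallest full subcategory of $\mathcal K(\operatorname{proj} R)$ that contains the complex $R$ concentrated in degree $0$ and is closed under shifts, direct summands, and those coproducts that exist in $\mathcal K(\operatorname{proj} R)$ (its objects are also called split complexes). Then for every $X\in\mathcal K(\operatorname{proj}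 R)$ the following are equivalent. 1. $X$ is Gorenstein projective. 2. There are objects $X_t\in\mathcal K(\operatorname{proj} R)$ and $P_t\in\operatorname{Add} R$ $(t\in\mathbb Z)$ with $X\cong X_0$ in $\mathcal K(\operatorname{proj} R)$ and, for each $t\in\mathbb Z$, a cohomologically ghost triangle $X_{t+1}\to P_t\to X_t\to X_{t+1}[1]$ in $\mathcal K(\operatorname{proj} R)$ whose $R$-dual $X_t^\ast\to P_t^\ast\to X_{t+1}^\ast\to X_t^\ast[1]$ is also cohomologically ghost. 3. There are objects $X_t\in\mathcal K(\operatorname{proj} R)$ and Gorenstein projective objects $G_t\in\mathcal K(\operatorname{proj} R)$ $(t\in\mathbb Z)$ with $X\cong X_0$ in $\mathcal K(\operatorname{proj} R)$ and, for each $t\in\mathbb Z$, a cohomologically ghost triangle $X_{t+1}\to G_t\to X_t\to X_{t+1}[1]$ in $\mathcal K(\operatorname{proj} R)$ whose $R$-dual $X_t^\ast\to G_t^\ast\to X_{t+1}^\ast\to X_t^\ast[1]$ is also cohomologically ghost. -/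

import Mathlib

open CategoryTheory Limits Pretriangulated

universe u

noncomputable section

namespace StableComplex

/-! Right `R`-modules are objects of `ModuleCat Rᵐᵒᵖ`; right `Rᵐᵒᵖ`-modules are left `R`-modules,
i.e. objects of `ModuleCat R`. The definitions below that do not involve duals are given
for (left) modules over an arbitrary ring `A` and are used for `A = Rᵐᵒᵖ` and `A = R`. -/

/-! ### Finitely generated projective modules -/

/-- The property of being a finitely generated projective module. -/
def isFGProj (A : Type u) [Ring A] : ObjectProperty (ModuleCat.{u} A) :=
  fun M => Module.Finite A M ∧ Module.Projective A M

/-- The category of finitely generated projective `A`-modules. -/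
abbrev FGProj (A : Type u) [Ring A] : Type (u + 1) := (isFGProj A).FullSubcategory

/-- The inclusion of finitely generated projective modules into all modules. -/
abbrev FGProj.incl (A : Type u) [Ring A] : FGProj A ⥤ ModuleCat.{u} A := (isFGProj A).ι

theorem isFGProj_of_iso {A : Type u} [Ring A] {M N : ModuleCat.{u} A} (e : M ≅ N)
    (h : isFGProj A M) : isFGProj A N := by
  obtain ⟨h₁, h₂⟩ := h
  exact ⟨Module.Finite.equiv e.toLinearEquiv, Module.Projective.of_equiv e.toLinearEquiv⟩

instance (A : Type u) [Ring A] : (isFGProj A).IsClosedUnderIsomorphisms where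
  of_iso e h := isFGProj_of_iso e h

instance (A : Type u) [Ring A] : (isFGProj A).ContainsZero where
  exists_zero :=
    ⟨ModuleCat.of A PUnit, ModuleCat.isZero_of_subsingleton _,
      inferInstanceAs (Module.Finite A PUnit.{u + 1}),
      inferInstanceAs (Module.Projective A PUnit.{u + 1})⟩

instance (A : Type u) [Ring A] : HasBinaryProducts (FGProj A) := by
  have : (isFGProj A).IsClosedUnderLimitsOfShape (Discrete WalkingPair) := by
    refine ObjectProperty.IsClosedUnderLimitsOfShape.mk' ?_
    rintro _ ⟨F, hF⟩
    have h₁ := hF ⟨WalkingPair.left⟩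
    have h₂ := hF ⟨WalkingPair.right⟩
    have e : limit F ≅ ModuleCat.of A (F.obj ⟨WalkingPair.left⟩ × F.obj ⟨WalkingPair.right⟩) :=
      HasLimit.isoOfNatIso (diagramIsoPair F) ≪≫ (biprod.isoProd _ _).symm ≪≫
        ModuleCat.biprodIsoProd _ _
    refine isFGProj_of_iso e.symm ⟨?_, ?_⟩
    · have := h₁.1
      have := h₂.1
      exact inferInstanceAs (Module.Finite A (_ × _))
    · have := h₁.2
      have := h₂.2
      exact inferInstanceAs (Module.Projective A (_ × _))
  exact inferInstanceAs (HasLimitsOfShape (Discrete WalkingPair) (isFGProj A).FullSubcategory)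

instance (A : Type u) [Ring A] : HasBinaryBiproducts (FGProj A) :=
  HasBinaryBiproducts.of_hasBinaryProducts

/-! ### The homotopy category of complexes of finitely generated projective modules -/

/-- The homotopy category `K(proj A)` of unbounded cochain complexes of finitely generated
projective `A`-modules, with its triangulated structure. -/
abbrev KProj (A : Type u) [Ring A] : Type (u + 1) :=
  HomotopyCategory (FGProj A) (ComplexShape.up ℤ)

/-- The `i`-th cohomology module, as a functor on `K(proj A)`. -/
def cohomology (A : Type u) [Ring A] (i : ℤ) : KProj A ⥤ ModuleCat.{u} A :=
  (FGProj.incl A).mapHomotopyCategory (ComplexShape.up ℤ) ⋙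
    HomotopyCategory.homologyFunctor (ModuleCat.{u} A) (ComplexShape.up ℤ) i

/-- The complex of `A`-modules underlying an object of `K(proj A)`. -/
def toComplex {A : Type u} [Ring A] (X : KProj A) : CochainComplex (ModuleCat.{u} A) ℤ :=
  ((FGProj.incl A).mapHomologicalComplex (ComplexShape.up ℤ)).obj X.as

/-- The module `Cⁱ(X)`, the cokernel of the differential `Xⁱ⁻¹ ⟶ Xⁱ`. -/
def coker {A : Type u} [Ring A] (X : KProj A) (i : ℤ) : ModuleCat.{u} A :=
  cokernel ((toComplex X).d (i - 1) i)

/-- The sequence `0 ⟶ Hⁱ(X) ⟶ Hⁱ(Y) ⟶ Hⁱ(Z) ⟶ 0` is exact for all `i`. -/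
def IsCohShortExact {A : Type u} [Ring A] {X Y Z : KProj A} (f : X ⟶ Y) (g : Y ⟶ Z) : Prop :=
  ∀ i : ℤ, Function.Injective ((cohomology A i).map f).hom ∧
    Function.Exact ((cohomology A i).map f).hom ((cohomology A i).map g).hom ∧
    Function.Surjective ((cohomology A i).map g).hom

/-- Cohomologically ghost triangles. -/
def IsCohGhost {A : Type u} [Ring A] (T : Triangle (KProj A)) : Prop :=
  T ∈ distTriang (KProj A) ∧ IsCohShortExact T.mor₁ T.mor₂

/-! ### The dual -/

section Dual

variable (R : Type u) [Ring R]

theorem isFGProj_dual (M : ModuleCat.{u} Rᵐᵒᵖ) (h : isFGProj Rᵐᵒᵖ M) :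
    isFGProj R (ModuleCat.of R (M →ₗ[Rᵐᵒᵖ] R)) := by
  obtain ⟨h₁, h₂⟩ := h
  obtain ⟨n, p, s, -, -, hps⟩ := Module.Finite.exists_comp_eq_id_of_projective Rᵐᵒᵖ M
  let e : ((Fin n → Rᵐᵒᵖ) →ₗ[Rᵐᵒᵖ] R) ≃ₗ[R] (Fin n → R) := LinearEquiv.piRing Rᵐᵒᵖ R (Fin n) R
  let a : (M →ₗ[Rᵐᵒᵖ] R) →ₗ[R] ((Fin n → Rᵐᵒᵖ) →ₗ[Rᵐᵒᵖ] R) :=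
    { toFun := fun φ => φ ∘ₗ p, map_add' := fun _ _ => rfl, map_smul' := fun _ _ => rfl }
  let b : ((Fin n → Rᵐᵒᵖ) →ₗ[Rᵐᵒᵖ] R) →ₗ[R] (M →ₗ[Rᵐᵒᵖ] R) :=
    { toFun := fun φ => φ ∘ₗ s, map_add' := fun _ _ => rfl, map_smul' := fun _ _ => rfl }
  have hba : ∀ φ, b (a φ) = φ := fun φ => by
    change (φ ∘ₗ p) ∘ₗ s = φ
    rw [LinearMap.comp_assoc, hps, LinearMap.comp_id]
  refine ⟨?_, ?_⟩
  · exact Module.Finite.of_surjective (b ∘ₗ e.symm.toLinearMap) (fun φ => ⟨e (a φ), by simp [hba]⟩)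
  · exact Module.Projective.of_split (e.toLinearMap ∘ₗ a) (b ∘ₗ e.symm.toLinearMap)
      (by ext φ : 1; simp [hba])

/-- The `R`-dual `Hom_R(-, R)` from finitely generated projective right `R`-modules to finitely
generated projective left `R`-modules; the left action is `(r • φ) m = r * φ m`. -/
def dualFunctor : (FGProj Rᵐᵒᵖ)ᵒᵖ ⥤ FGProj R where
  obj M := ⟨ModuleCat.of R (M.unop.obj →ₗ[Rᵐᵒᵖ] R), isFGProj_dual R M.unop.obj M.unop.property⟩
  map f := ObjectProperty.homMk (ModuleCat.ofHom
    { toFun := fun φ => φ ∘ₗ f.unop.hom.hom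
      map_add' := fun _ _ => rfl
      map_smul' := fun _ _ => rfl })

instance : (dualFunctor R).Additive where
  map_add {M N f g} := by
    apply ObjectProperty.hom_ext
    apply ModuleCat.hom_ext
    refine LinearMap.ext fun φ => LinearMap.ext fun x => ?_
    exact LinearMap.map_add (φ : M.unop.obj →ₗ[Rᵐᵒᵖ] R) _ _

/-- The `R`-dual complex: `(X*)ⁱ = Hom_R(X⁻ⁱ, R)`, with the dual differentials. -/
def dualComplex (X : CochainComplex (FGProj Rᵐᵒᵖ) ℤ) : CochainComplex (FGProj R) ℤ where
  X i := (dualFunctor R).obj (Opposite.op (X.X (-i)))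
  d i j := (dualFunctor R).map (X.d (-j) (-i)).op
  shape i j h := by
    have : X.d (-j) (-i) = 0 := X.shape _ _ (by
      simp only [ComplexShape.up_Rel] at h ⊢
      lia)
    rw [this]
    exact (dualFunctor R).map_zero _ _
  d_comp_d' i j k _ _ := by
    rw [← Functor.map_comp, ← op_comp, X.d_comp_d]
    exact (dualFunctor R).map_zero _ _

/-- The `R`-dual of a chain map. -/
def dualComplexMap {X Y : CochainComplex (FGProj Rᵐᵒᵖ) ℤ} (f : X ⟶ Y) :
    dualComplex R Y ⟶ dualComplex R X where
  f i := (dualFunctor R).map (f.f (-i)).op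
  comm' i j _ := by
    dsimp only [dualComplex]
    rw [← Functor.map_comp, ← Functor.map_comp, ← op_comp, ← op_comp, f.comm]

/-- The `R`-dual of a homotopy. -/
def dualHomotopy {X Y : CochainComplex (FGProj Rᵐᵒᵖ) ℤ} {f g : X ⟶ Y} (h : Homotopy f g) :
    Homotopy (dualComplexMap R f) (dualComplexMap R g) where
  hom i j := (dualFunctor R).map (h.hom (-j) (-i)).op
  zero i j hij := by
    have : h.hom (-j) (-i) = 0 := h.zero _ _ (by
      simp only [ComplexShape.up_Rel] at hij ⊢
      lia)
    rw [this]
    exact (dualFunctor R).map_zero _ _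
  comm i := by
    have hc := h.comm (-i)
    rw [dNext_eq h.hom (show (ComplexShape.up ℤ).Rel (-i) (-(i - 1)) by
        simp only [ComplexShape.up_Rel]; lia),
      prevD_eq h.hom (show (ComplexShape.up ℤ).Rel (-(i + 1)) (-i) by
        simp only [ComplexShape.up_Rel]; lia)] at hc
    let H : ∀ i j, (dualComplex R Y).X i ⟶ (dualComplex R X).X j :=
      fun i j => (dualFunctor R).map (h.hom (-j) (-i)).op
    change _ = dNext i H + prevD i H + _
    rw [dNext_eq H (show (ComplexShape.up ℤ).Rel i (i + 1) by simp),
      prevD_eq H (show (ComplexShape.up ℤ).Rel (i - 1) i by simp)]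
    have hc' := congrArg (fun φ => (dualFunctor R).map (Quiver.Hom.op φ)) hc
    simp only [op_add, op_comp, Functor.map_add, Functor.map_comp] at hc'
    rw [add_comm ((dualFunctor R).map _ ≫ (dualFunctor R).map _)] at hc'
    exact hc'

/-- The `R`-dual functor `(-)* : K(proj R) ⟶ K(proj Rᵒᵖ)`, written as a covariant functor to the
opposite category. -/
def dual : KProj Rᵐᵒᵖ ⥤ (KProj R)ᵒᵖ :=
  CategoryTheory.Quotient.lift (homotopic (FGProj Rᵐᵒᵖ) (ComplexShape.up ℤ))
    { obj := fun X => Opposite.op ((HomotopyCategory.quotient _ _).obj (dualComplex R X))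
      map := fun f => ((HomotopyCategory.quotient _ _).map (dualComplexMap R f)).op
      map_id := fun X => by
        have : dualComplexMap R (𝟙 X) = 𝟙 _ := by
          ext i : 1
          exact (dualFunctor R).map_id _
        rw [this, CategoryTheory.Functor.map_id]
        rfl
      map_comp := fun f g => by
        have : dualComplexMap R (f ≫ g) = dualComplexMap R g ≫ dualComplexMap R f := by
          ext i : 1
          exact (dualFunctor R).map_comp _ _
        rw [this, Functor.map_comp]
        rfl }
    (fun _ _ _ _ ⟨h⟩ => congrArg Quiver.Hom.op
      (HomotopyCategory.eq_of_homotopy _ _ (dualHomotopy R h)))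

variable {R}

/-- The `R`-dual `X*` of an object of `K(proj R)`. -/
abbrev dualObj (X : KProj Rᵐᵒᵖ) : KProj R := ((dual R).obj X).unop

/-- The `R`-dual `f* : Y* ⟶ X*` of a morphism `f : X ⟶ Y`. -/
abbrev dualMap {X Y : KProj Rᵐᵒᵖ} (f : X ⟶ Y) : dualObj Y ⟶ dualObj X := ((dual R).map f).unop

end Dual

/-! ### `Add R` and Gorenstein projective complexes -/

section

variable (R : Type u) [Ring R]

/-- `R` as a right module over itself. -/
def regularRight : FGProj Rᵐᵒᵖ :=
  ⟨ModuleCat.of Rᵐᵒᵖ R,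
    Module.Finite.equiv (MulOpposite.opLinearEquiv Rᵐᵒᵖ : R ≃ₗ[Rᵐᵒᵖ] Rᵐᵒᵖ).symm,
    Module.Projective.of_equiv (MulOpposite.opLinearEquiv Rᵐᵒᵖ : R ≃ₗ[Rᵐᵒᵖ] Rᵐᵒᵖ).symm⟩

/-- `Add R`: the smallest full subcategory of `K(proj R)` that contains the complex `R`
concentrated in degree `0` and is closed under shifts, direct summands and the coproducts that
exist in `K(proj R)`. -/
def AddR : ObjectProperty (KProj Rᵐᵒᵖ) := fun X =>
  ∀ Q : ObjectProperty (KProj Rᵐᵒᵖ),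
    Q ((HomotopyCategory.quotient _ _).obj
      ((HomologicalComplex.single (FGProj Rᵐᵒᵖ) (ComplexShape.up ℤ) 0).obj (regularRight R))) →
    Q.IsStableUnderShift ℤ → Q.IsStableUnderRetracts →
    (∀ J : Type u, Q.IsClosedUnderColimitsOfShape (Discrete J)) → Q X

variable {R}

/-- `X` is Gorenstein projective: `Ext_R^j(Cⁱ(X), R) = 0` (right modules) and
`Ext_{Rᵒᵖ}^j(Cⁱ(X*), R) = 0` (left modules) for all integers `i` and all `j > 0`. -/
def IsGorensteinProjective (X : KProj Rᵐᵒᵖ) : Prop :=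
  ∀ (i : ℤ) (j : ℕ), 0 < j →
    Subsingleton (Abelian.Ext (coker X i) (ModuleCat.of Rᵐᵒᵖ R) j) ∧
    Subsingleton (Abelian.Ext (coker (dualObj X) i) (ModuleCat.of R R) j)

end

end StableComplex

end

/-! A distinguished triangle in the homotopy category is represented by a degreewise split exact
sequence of complexes `X → Y → Z` (`nonempty_splitModel`), and such a sequence stays degreewise
split after dualizing. Since `Y → Z` is surjective in each degree, it is surjective on cohomology
exactly when it is surjective on cocycles (`CyclesSurj`). In that case the triangle is
cohomologically ghost, and the sequences `0 → Cⁱ(X) → Cⁱ(Y) → Cⁱ(Z) → 0` are exact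
(`cokerShortComplex_shortExact`).

A cocycle of `X*` is a linear map `Cⁱ(X) → R`. So the dual triangle is ghost exactly when every map
`Cⁱ(X) → R` extends to `Cⁱ(Y)` (`cyclesSurj_dual_iff`), and biduality gives the mirror statement
(`cyclesSurj_iff_dual`). Ghostness of the dual triangle is thus exactness of `Hom(-, R)` on the
cokernel sequences, which the long exact `Ext` sequence relates to `Ext¹(Cⁱ(Z), R)`.

From 1 to 2: the cocycles of `X` are finitely generated, so a complex of projectives with zero
differential maps onto them. The cone construction gives a ghost triangle, and `Ext¹(Cⁱ(X), R) = 0`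
makes its dual ghost; the new term is again Gorenstein projective (`IsGorensteinProjective.first`).
Generators of the cocycles of `X*` give the step in the other direction
(`IsGorensteinProjective.third`). Iterating both ways produces the resolution.

From 2 to 3: every object of `Add R` is a retract of a complex with zero differential
(`exists_retract_zeroDiff`). Such a complex and its dual have projective cokernels, and Gorenstein
projectivity passes to retracts.

From 3 to 1: the two ghost conditions give `Ext¹(Cⁱ(X_t), R) = 0` for all `t`, and dimension
shifting along the resolution gives the higher groups. The dual groups shift in the opposite
direction, so both halves of the resolution are needed (`isGorensteinProjective_of_resolution`). -/

noncomputable section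

namespace StableComplex

/-! ### Vanishing of `Ext` -/

section Ext

variable {A : Type u} [Ring A]

/-- `Ext^j(M, N) = 0` for all `j > 0`. -/
def ExtVanish (N M : ModuleCat.{u} A) : Prop :=
  ∀ j : ℕ, 0 < j → Subsingleton (Abelian.Ext M N j)

variable {N : ModuleCat.{u} A} {S : ShortComplex (ModuleCat.{u} A)}

/-- A class in `Ext¹(X₃, N)` dies in `Ext¹(X₂, N) = 0`, so it is the connecting image of some `φ :
X₁ ⟶ N`. As `φ` extends over `X₂`, that image is zero. -/
theorem subsingleton_ext_one_third (hS : S.ShortExact)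
    (h₂ : Subsingleton (Abelian.Ext S.X₂ N 1))
    (hsurj : ∀ φ : S.X₁ ⟶ N, ∃ ψ : S.X₂ ⟶ N, S.f ≫ ψ = φ) :
    Subsingleton (Abelian.Ext S.X₃ N 1) := by
  refine subsingleton_of_forall_eq 0 fun x => ?_
  obtain ⟨x₁, rfl⟩ := Abelian.Ext.contravariant_sequence_exact₃ hS N x
    (Subsingleton.elim _ _) (n₀ := 0) (add_zero 1)
  obtain ⟨φ, rfl⟩ := (Abelian.Ext.mk₀_bijective _ _).surjective x₁
  obtain ⟨ψ, rfl⟩ := hsurj φ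
  rw [← Abelian.Ext.mk₀_comp_mk₀, ← Abelian.Ext.comp_assoc (h₁₂ := add_zero 1) (h₂₃ := add_zero 0)
    (h := by simp), hS.extClass_comp, Abelian.Ext.zero_comp]

theorem exists_extension_of_subsingleton_ext_one (hS : S.ShortExact)
    (h₃ : Subsingleton (Abelian.Ext S.X₃ N 1)) (φ : S.X₁ ⟶ N) :
    ∃ ψ : S.X₂ ⟶ N, S.f ≫ ψ = φ := by
  obtain ⟨x₂, hx₂⟩ := Abelian.Ext.contravariant_sequence_exact₁ hS N (Abelian.Ext.mk₀ φ)
    (n₁ := 1) (add_zero 1) (Subsingleton.elim _ _)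
  obtain ⟨ψ, rfl⟩ := (Abelian.Ext.mk₀_bijective _ _).surjective x₂
  refine ⟨ψ, (Abelian.Ext.mk₀_bijective _ _).injective ?_⟩
  rw [← hx₂, Abelian.Ext.mk₀_comp_mk₀]

theorem subsingleton_ext_succ_third (hS : S.ShortExact) (j : ℕ)
    (h₁ : Subsingleton (Abelian.Ext S.X₁ N j)) (h₂ : Subsingleton (Abelian.Ext S.X₂ N (j + 1))) :
    Subsingleton (Abelian.Ext S.X₃ N (j + 1)) := by
  refine subsingleton_of_forall_eq 0 fun x => ?_
  obtain ⟨x₁, rfl⟩ := Abelian.Ext.contravariant_sequence_exact₃ hS N x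
    (Subsingleton.elim _ _) (n₀ := j) (add_comm _ _)
  rw [Subsingleton.elim x₁ 0, Abelian.Ext.comp_zero]

theorem subsingleton_ext_first (hS : S.ShortExact) (j : ℕ)
    (h₂ : Subsingleton (Abelian.Ext S.X₂ N j)) (h₃ : Subsingleton (Abelian.Ext S.X₃ N (j + 1))) :
    Subsingleton (Abelian.Ext S.X₁ N j) := by
  refine subsingleton_of_forall_eq 0 fun x => ?_
  obtain ⟨x₂, rfl⟩ := Abelian.Ext.contravariant_sequence_exact₁ hS N x
    (n₁ := j + 1) (add_comm _ _) (Subsingleton.elim _ _)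
  rw [Subsingleton.elim x₂ 0, Abelian.Ext.comp_zero]

theorem ExtVanish.first (hS : S.ShortExact) (h₂ : ExtVanish N S.X₂) (h₃ : ExtVanish N S.X₃) :
    ExtVanish N S.X₁ :=
  fun j hj => subsingleton_ext_first hS j (h₂ j hj) (h₃ _ j.succ_pos)

theorem ExtVanish.third (hS : S.ShortExact) (h₁ : ExtVanish N S.X₁) (h₂ : ExtVanish N S.X₂)
    (hsurj : ∀ φ : S.X₁ ⟶ N, ∃ ψ : S.X₂ ⟶ N, S.f ≫ ψ = φ) : ExtVanish N S.X₃ := by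
  rintro (_ | _ | j) hj
  · lia
  · exact subsingleton_ext_one_third hS (h₂ 1 one_pos) hsurj
  · exact subsingleton_ext_succ_third hS _ (h₁ _ j.succ_pos) (h₂ _ (j + 1).succ_pos)

theorem ExtVanish.of_projective {M : ModuleCat.{u} A} (h : Module.Projective A M) :
    ExtVanish N M := by
  have : Projective M := M.projective_of_categoryTheory_projective
  rintro (_ | j) hj
  · lia
  · exact Abelian.Ext.subsingleton_of_projective _ _ _

/-- Vanishing of `Ext` passes to retracts modulo projectives. -/
theorem subsingleton_ext_of_retract_mod_projective {M M' Q : ModuleCat.{u} A} (hQ : Module.Projective A Q)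
    (s : M ⟶ M') (r : M' ⟶ M) (a : M ⟶ Q) (b : Q ⟶ M) (hid : 𝟙 M = s ≫ r + a ≫ b)
    {j : ℕ} (hj : 0 < j) (h : Subsingleton (Abelian.Ext M' N j)) :
    Subsingleton (Abelian.Ext M N j) := by
  have h₂ := ExtVanish.of_projective (N := N) hQ j hj
  refine subsingleton_of_forall_eq 0 fun x => ?_
  rw [← Abelian.Ext.mk₀_id_comp x, hid, Abelian.Ext.mk₀_add, Abelian.Ext.add_comp,
    ← Abelian.Ext.mk₀_comp_mk₀, ← Abelian.Ext.mk₀_comp_mk₀,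
    Abelian.Ext.comp_assoc (h₁₂ := add_zero 0) (h₂₃ := zero_add j) (h := by simp),
    Abelian.Ext.comp_assoc (h₁₂ := add_zero 0) (h₂₃ := zero_add j) (h := by simp),
    Subsingleton.elim ((Abelian.Ext.mk₀ r).comp x (zero_add j)) 0,
    Subsingleton.elim ((Abelian.Ext.mk₀ b).comp x (zero_add j)) 0, Abelian.Ext.comp_zero,
    Abelian.Ext.comp_zero, add_zero]

end Ext

/-! ### Complexes of modules -/

section ModuleComplex

variable {A : Type u} [Ring A] {K L : CochainComplex (ModuleCat.{u} A) ℤ}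

/-- A chain map is surjective on cocycles. -/
def CyclesSurj (f : K ⟶ L) : Prop :=
  ∀ i j : ℤ, i + 1 = j → ∀ x : L.X i, (L.d i j).hom x = 0 →
    ∃ y : K.X i, (K.d i j).hom y = 0 ∧ (f.f i).hom y = x

/-- Every linear map `Kʲ ⟶ N` which vanishes on boundaries factors through a linear map
`Lʲ ⟶ N` which vanishes on boundaries. -/
def CocyclesExtend (N : ModuleCat.{u} A) (f : K ⟶ L) : Prop :=
  ∀ i j : ℤ, i + 1 = j → ∀ φ : K.X j ⟶ N, K.d i j ≫ φ = 0 →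
    ∃ ψ : L.X j ⟶ N, L.d i j ≫ ψ = 0 ∧ f.f j ≫ ψ = φ

theorem exists_iCycles_eq {i j : ℤ} (hij : i + 1 = j) (x : K.X i) (hx : (K.d i j).hom x = 0) :
    ∃ z : K.cycles i, (K.iCycles i).hom z = x := by
  have h := ShortComplex.exact_of_f_is_kernel
    (ShortComplex.mk (K.iCycles i) (K.d i j) (K.iCycles_d i j))
    (K.cyclesIsKernel i j (by simpa using hij))
  exact (ShortComplex.moduleCat_exact_iff _).1 h x hx

theorem iCycles_injective (K : CochainComplex (ModuleCat.{u} A) ℤ) (i : ℤ) :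
    Function.Injective (K.iCycles i).hom :=
  (ModuleCat.mono_iff_injective _).1 inferInstance

theorem homologyπ_surjective (K : CochainComplex (ModuleCat.{u} A) ℤ) (i : ℤ) :
    Function.Surjective (K.homologyπ i).hom :=
  (ModuleCat.epi_iff_surjective _).1 inferInstance

theorem exists_toCycles_eq {i j : ℤ} (hij : i + 1 = j) (z : K.cycles j)
    (hz : (K.homologyπ j).hom z = 0) : ∃ x : K.X i, (K.toCycles i j).hom x = z := by
  have h := ShortComplex.exact_of_g_is_cokernel
    (ShortComplex.mk (K.toCycles i j) (K.homologyπ j) (K.toCycles_comp_homologyπ i j))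
    (K.homologyIsCokernel i j (by simp [← hij]))
  exact (ShortComplex.moduleCat_exact_iff _).1 h z hz

theorem d_iCycles (i j : ℤ) (z : K.cycles i) : (K.d i j).hom ((K.iCycles i).hom z) = 0 :=
  congrArg (fun f => f.hom z) (K.iCycles_d i j)

theorem homologyMap_π (f : K ⟶ L) (i : ℤ) (z : K.cycles i) :
    (HomologicalComplex.homologyMap f i).hom ((K.homologyπ i).hom z) =
      (L.homologyπ i).hom ((HomologicalComplex.cyclesMap f i).hom z) :=
  congrArg (fun f => f.hom z) (HomologicalComplex.homologyπ_naturality f i)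

theorem iCycles_cyclesMap (f : K ⟶ L) (i : ℤ) (z : K.cycles i) :
    (L.iCycles i).hom ((HomologicalComplex.cyclesMap f i).hom z) =
      (f.f i).hom ((K.iCycles i).hom z) :=
  congrArg (fun f => f.hom z) (HomologicalComplex.cyclesMap_i f i)

theorem iCycles_toCycles (i j : ℤ) (x : K.X i) :
    (K.iCycles j).hom ((K.toCycles i j).hom x) = (K.d i j).hom x :=
  congrArg (fun f => f.hom x) (K.toCycles_i i j)

theorem hom_f_d (f : K ⟶ L) (i j : ℤ) (x : K.X i) :
    (L.d i j).hom ((f.f i).hom x) = (f.f j).hom ((K.d i j).hom x) :=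
  congrArg (fun f => f.hom x) (f.comm i j)

theorem hom_d_d (i j k : ℤ) (x : K.X i) : (K.d j k).hom ((K.d i j).hom x) = 0 :=
  congrArg (fun f => f.hom x) (K.d_comp_d i j k)

theorem CyclesSurj.of_homologyMap {f : K ⟶ L} (hf : ∀ i, Function.Surjective (f.f i).hom)
    (hH : ∀ i, Function.Surjective (HomologicalComplex.homologyMap f i).hom) : CyclesSurj f := by
  intro i j hij x hx
  obtain ⟨z, rfl⟩ := exists_iCycles_eq hij x hx
  obtain ⟨h, hh⟩ := hH i ((L.homologyπ i).hom z)
  obtain ⟨w, rfl⟩ := homologyπ_surjective K i h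
  rw [homologyMap_π] at hh
  -- The cocycle `w` hits `z` only up to a boundary; degreewise surjectivity lifts the bounding
  -- element `l`, and adding the boundary of that lift corrects `w`.
  obtain ⟨l, hl⟩ := exists_toCycles_eq (i := i - 1) (sub_add_cancel i 1)
    (z - (HomologicalComplex.cyclesMap f i).hom w) (by rw [map_sub, hh, sub_self])
  obtain ⟨k, rfl⟩ := hf _ l
  refine ⟨(K.iCycles i).hom w + (K.d (i - 1) i).hom k, ?_, ?_⟩
  · rw [map_add, d_iCycles, hom_d_d, add_zero]
  · rw [map_add, ← hom_f_d, ← iCycles_toCycles, hl, map_sub, iCycles_cyclesMap, add_sub_cancel]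

theorem CyclesSurj.homologyMap_surjective {f : K ⟶ L} (hf : CyclesSurj f) (i : ℤ) :
    Function.Surjective (HomologicalComplex.homologyMap f i).hom := by
  intro h
  obtain ⟨z, rfl⟩ := homologyπ_surjective L i h
  obtain ⟨y, hy, hyz⟩ := hf i (i + 1) rfl _ (d_iCycles i (i + 1) z)
  obtain ⟨w, rfl⟩ := exists_iCycles_eq rfl y hy
  refine ⟨(K.homologyπ i).hom w, ?_⟩
  rw [homologyMap_π]
  congr 1
  apply iCycles_injective
  rw [iCycles_cyclesMap, hyz]

/-- The map induced on cokernels of differentials. -/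
def cokerMap (f : K ⟶ L) (i : ℤ) : cokernel (K.d (i - 1) i) ⟶ cokernel (L.d (i - 1) i) :=
  cokernel.map _ _ (f.f (i - 1)) (f.f i) (f.comm _ _).symm

theorem π_cokerMap (f : K ⟶ L) (i : ℤ) :
    cokernel.π (K.d (i - 1) i) ≫ cokerMap f i = f.f i ≫ cokernel.π (L.d (i - 1) i) :=
  cokernel.π_desc _ _ _

theorem π_cokerMap_assoc (f : K ⟶ L) (i : ℤ) {N : ModuleCat.{u} A}
    (φ : cokernel (L.d (i - 1) i) ⟶ N) :
    cokernel.π (K.d (i - 1) i) ≫ cokerMap f i ≫ φ =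
      f.f i ≫ cokernel.π (L.d (i - 1) i) ≫ φ := by
  rw [← Category.assoc, π_cokerMap, Category.assoc]

theorem cokernelπ_surjective {M M' : ModuleCat.{u} A} (g : M ⟶ M') :
    Function.Surjective (cokernel.π g).hom :=
  (ModuleCat.epi_iff_surjective _).1 inferInstance

theorem cokernelπ_eq_zero_iff {M M' : ModuleCat.{u} A} (g : M ⟶ M') (x : M') :
    (cokernel.π g).hom x = 0 ↔ ∃ y, g.hom y = x := by
  constructor
  · exact (ShortComplex.moduleCat_exact_iff _).1 (ShortComplex.exact_cokernel g) x
  · rintro ⟨y, rfl⟩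
    exact congrArg (fun f => f.hom y) (cokernel.condition g)

theorem cokerMap_π (f : K ⟶ L) (i : ℤ) (x : K.X i) :
    (cokerMap f i).hom ((cokernel.π (K.d (i - 1) i)).hom x) =
      (cokernel.π (L.d (i - 1) i)).hom ((f.f i).hom x) :=
  congrArg (fun f => f.hom x) (π_cokerMap f i)

theorem CocyclesExtend.cokerMap {N : ModuleCat.{u} A} {f : K ⟶ L} (hf : CocyclesExtend N f)
    (i : ℤ) (φ : cokernel (K.d (i - 1) i) ⟶ N) : ∃ ψ, StableComplex.cokerMap f i ≫ ψ = φ := by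
  obtain ⟨ψ, hψ, h⟩ := hf (i - 1) i (sub_add_cancel i 1) (cokernel.π _ ≫ φ) (by simp)
  refine ⟨cokernel.desc _ ψ hψ, ?_⟩
  rw [← cancel_epi (cokernel.π _), π_cokerMap_assoc, cokernel.π_desc, h]

theorem CocyclesExtend.of_cokerMap {N : ModuleCat.{u} A} {f : K ⟶ L}
    (h : ∀ i (φ : cokernel (K.d (i - 1) i) ⟶ N), ∃ ψ, StableComplex.cokerMap f i ≫ ψ = φ) :
    CocyclesExtend N f := by
  intro i j hij φ hφ
  obtain rfl : i = j - 1 := by lia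
  obtain ⟨ψ, hψ⟩ := h j (cokernel.desc _ φ hφ)
  refine ⟨cokernel.π _ ≫ ψ, by simp, ?_⟩
  rw [← π_cokerMap_assoc, hψ, cokernel.π_desc]

/-- All positive `Ext` groups from the cokernels of the differentials of `K` to `N` vanish. -/
def CokerExtVanish (N : ModuleCat.{u} A) (K : CochainComplex (ModuleCat.{u} A) ℤ) : Prop :=
  ∀ i : ℤ, ExtVanish N (cokernel (K.d (i - 1) i))

/-- The `Ext` groups in degree `j` from the cokernels of the differentials of `K` to `N` vanish. -/
def CokerExtVanishAt (N : ModuleCat.{u} A) (j : ℕ) (K : CochainComplex (ModuleCat.{u} A) ℤ) :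
    Prop :=
  ∀ i : ℤ, Subsingleton (Abelian.Ext (cokernel (K.d (i - 1) i)) N j)

/-- `Cⁱ` is a homotopy invariant only up to projectives: in `1 = dh + hd + fg`, the term ending in a
boundary dies in the cokernel, and the other homotopy term factors through the projective `Kⁱ⁺¹`.
Positive `Ext` does not see the latter. -/
theorem CokerExtVanishAt.of_homotopy {N : ModuleCat.{u} A} {j : ℕ} (hj : 0 < j) (f : K ⟶ L)
    (g : L ⟶ K) (h : Homotopy (𝟙 K) (f ≫ g)) (hK : ∀ i, Module.Projective A (K.X i))
    (hL : CokerExtVanishAt N j L) : CokerExtVanishAt N j K := by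
  intro i
  refine subsingleton_ext_of_retract_mod_projective (hK (i + 1)) (cokerMap f i) (cokerMap g i)
    (cokernel.desc _ (K.d i (i + 1)) (K.d_comp_d _ _ _)) (h.hom (i + 1) i ≫ cokernel.π _) ?_ hj (hL i)
  have hc := h.comm i
  rw [dNext_eq h.hom (show (ComplexShape.up ℤ).Rel i (i + 1) by simp),
    prevD_eq h.hom (show (ComplexShape.up ℤ).Rel (i - 1) i by simp)] at hc
  have hc' : cokernel.π (K.d (i - 1) i) =
      K.d i (i + 1) ≫ h.hom (i + 1) i ≫ cokernel.π (K.d (i - 1) i) +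
        f.f i ≫ g.f i ≫ cokernel.π (K.d (i - 1) i) := by
    have := congrArg (fun φ => φ ≫ cokernel.π (K.d (i - 1) i)) hc
    simpa only [HomologicalComplex.id_f, Category.id_comp, Preadditive.add_comp, Category.assoc,
      cokernel.condition, comp_zero, add_zero, HomologicalComplex.comp_f] using this
  rw [← cancel_epi (cokernel.π _), Category.comp_id, Preadditive.comp_add, π_cokerMap_assoc,
    π_cokerMap, cokernel.π_desc_assoc, add_comm]
  exact hc'

/-! ### Short exact sequences of complexes and of their cokernels -/

section ShortExact

variable {N : ModuleCat.{u} A} {S : ShortComplex (CochainComplex (ModuleCat.{u} A) ℤ)}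

/-- The sequence of cokernels of differentials attached to a sequence of complexes. -/
@[simps] def cokerShortComplex (S : ShortComplex (CochainComplex (ModuleCat.{u} A) ℤ)) (i : ℤ) :
    ShortComplex (ModuleCat.{u} A) where
  f := cokerMap S.f i
  g := cokerMap S.g i
  zero := by
    rw [← cancel_epi (cokernel.π _), π_cokerMap_assoc, π_cokerMap, ← Category.assoc,
      ← HomologicalComplex.comp_f, S.zero]
    simp

/-- Right exactness is automatic; lifting cocycles is what makes the left map injective. -/
theorem cokerShortComplex_shortExact
    (hS : ∀ i, (S.map (HomologicalComplex.eval _ _ i)).ShortExact) (hg : CyclesSurj S.g) (i : ℤ) :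
    (cokerShortComplex S i).ShortExact := by
  have inj : ∀ i, Function.Injective (S.f.f i).hom := fun i => (hS i).moduleCat_injective_f
  have surj : ∀ i, Function.Surjective (S.g.f i).hom := fun i => (hS i).moduleCat_surjective_g
  have ex : ∀ i (x : S.X₂.X i), (S.g.f i).hom x = 0 → ∃ y : S.X₁.X i, (S.f.f i).hom y = x :=
    fun i => (ShortComplex.moduleCat_exact_iff _).1 (hS i).exact
  have zero : ∀ i y, (S.g.f i).hom ((S.f.f i).hom y) = 0 := fun i y =>
    congrArg (fun f => (f.f i).hom y) S.zero
  refine { exact := (ShortComplex.moduleCat_exact_iff _).2 ?_, mono_f := ?_, epi_g := ?_ }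
  · intro c hc
    obtain ⟨x, rfl⟩ := cokernelπ_surjective _ c
    change (cokerMap S.g i).hom _ = 0 at hc
    rw [cokerMap_π, cokernelπ_eq_zero_iff] at hc
    obtain ⟨w, hw⟩ := hc
    obtain ⟨v, rfl⟩ := surj _ w
    rw [hom_f_d] at hw
    obtain ⟨y, hy⟩ := ex i (x - (S.X₂.d (i - 1) i).hom v) (by
      rw [map_sub, sub_eq_zero]; exact hw.symm)
    refine ⟨(cokernel.π (S.X₁.d (i - 1) i)).hom y, ?_⟩
    change (cokerMap S.f i).hom _ = _
    rw [cokerMap_π, hy, map_sub, sub_eq_self, cokernelπ_eq_zero_iff]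
    exact ⟨_, rfl⟩
  · rw [ModuleCat.mono_iff_injective, cokerShortComplex_f]
    refine (injective_iff_map_eq_zero (cokerMap S.f i).hom).2 fun c hc => ?_
    obtain ⟨x, rfl⟩ := cokernelπ_surjective _ c
    rw [cokerMap_π, cokernelπ_eq_zero_iff] at hc
    obtain ⟨w, hw⟩ := hc
    -- Here `f x = d w`, so `g w` is a cocycle. Subtracting from `w` a cocycle with the same image
    -- moves `w` into the image of `S.X₁` without changing `d w`.
    obtain ⟨z, hz, hzw⟩ := hg (i - 1) i (sub_add_cancel i 1) ((S.g.f _).hom w) (by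
      rw [hom_f_d, hw, zero])
    obtain ⟨y, hy⟩ := ex (i - 1) (w - z) (by rw [map_sub, sub_eq_zero]; exact hzw.symm)
    rw [cokernelπ_eq_zero_iff]
    refine ⟨y, inj i ?_⟩
    rw [← hom_f_d, hy, map_sub, hz, hw, sub_zero]
  · rw [ModuleCat.epi_iff_surjective]
    intro c
    obtain ⟨x, rfl⟩ := cokernelπ_surjective _ c
    obtain ⟨y, rfl⟩ := surj i x
    exact ⟨(cokernel.π (S.X₂.d (i - 1) i)).hom y, cokerMap_π _ _ _⟩

theorem shortExact_homology (hS : ∀ i, (S.map (HomologicalComplex.eval _ _ i)).ShortExact)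
    (hg : CyclesSurj S.g) (i : ℤ) :
    Function.Injective (HomologicalComplex.homologyMap S.f i).hom ∧
      Function.Exact (HomologicalComplex.homologyMap S.f i).hom
        (HomologicalComplex.homologyMap S.g i).hom ∧
      Function.Surjective (HomologicalComplex.homologyMap S.g i).hom := by
  have hS' := HomologicalComplex.shortExact_of_degreewise_shortExact S hS
  have hij : (ComplexShape.up ℤ).Rel (i - 1) i := by simp
  have : Epi (HomologicalComplex.homologyMap S.g (i - 1)) :=
    (ModuleCat.epi_iff_surjective _).2 (hg.homologyMap_surjective _)
  -- The connecting map vanishes because the map preceding it in the long exact sequence is onto;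
  -- hence the next map is injective.
  have hδ : hS'.δ (i - 1) i hij = 0 := by
    rw [← cancel_epi (HomologicalComplex.homologyMap S.g (i - 1)), hS'.comp_δ, comp_zero]
  have hm : Mono (HomologicalComplex.homologyMap S.f i) :=
    (ShortComplex.exact_iff_mono _ hδ).1 (hS'.homology_exact₁ (i - 1) i hij)
  exact ⟨(ModuleCat.mono_iff_injective _).1 hm,
    (ShortComplex.ShortExact.moduleCat_exact_iff_function_exact _).1 (hS'.homology_exact₂ i),
    hg.homologyMap_surjective i⟩

theorem CokerExtVanish.first (hS : ∀ i, (S.map (HomologicalComplex.eval _ _ i)).ShortExact)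
    (hg : CyclesSurj S.g) (h₂ : CokerExtVanish N S.X₂) (h₃ : CokerExtVanish N S.X₃) :
    CokerExtVanish N S.X₁ :=
  fun i => ExtVanish.first (cokerShortComplex_shortExact hS hg i) (h₂ i) (h₃ i)

theorem CokerExtVanishAt.third_one (hS : ∀ i, (S.map (HomologicalComplex.eval _ _ i)).ShortExact)
    (hg : CyclesSurj S.g) (hf : CocyclesExtend N S.f) (h₂ : CokerExtVanish N S.X₂) :
    CokerExtVanishAt N 1 S.X₃ :=
  fun i => subsingleton_ext_one_third (cokerShortComplex_shortExact hS hg i) (h₂ i 1 one_pos)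
    (hf.cokerMap i)

theorem CokerExtVanishAt.third_succ (hS : ∀ i, (S.map (HomologicalComplex.eval _ _ i)).ShortExact)
    (hg : CyclesSurj S.g) {j : ℕ} (h₁ : CokerExtVanishAt N j S.X₁) (h₂ : CokerExtVanish N S.X₂) :
    CokerExtVanishAt N (j + 1) S.X₃ :=
  fun i => subsingleton_ext_succ_third (cokerShortComplex_shortExact hS hg i) j (h₁ i)
    (h₂ i _ j.succ_pos)

theorem CokerExtVanish.third (hS : ∀ i, (S.map (HomologicalComplex.eval _ _ i)).ShortExact)
    (hg : CyclesSurj S.g) (hf : CocyclesExtend N S.f) (h₁ : CokerExtVanish N S.X₁)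
    (h₂ : CokerExtVanish N S.X₂) : CokerExtVanish N S.X₃ :=
  fun i => ExtVanish.third (cokerShortComplex_shortExact hS hg i) (h₁ i) (h₂ i) (hf.cokerMap i)

theorem CocyclesExtend.of_cokerExtVanish
    (hS : ∀ i, (S.map (HomologicalComplex.eval _ _ i)).ShortExact)
    (hg : CyclesSurj S.g) (h₃ : CokerExtVanish N S.X₃) : CocyclesExtend N S.f :=
  .of_cokerMap fun i => exists_extension_of_subsingleton_ext_one
    (cokerShortComplex_shortExact hS hg i) (h₃ i 1 one_pos)

end ShortExact

end ModuleComplex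

/-! ### Duality for complexes of finitely generated projective modules -/

/-- The functor from complexes of finitely generated projective modules to complexes of modules. -/
abbrev inclComplex (A : Type u) [Ring A] :
    CochainComplex (FGProj A) ℤ ⥤ CochainComplex (ModuleCat.{u} A) ℤ :=
  (FGProj.incl A).mapHomologicalComplex (ComplexShape.up ℤ)

section Biduality

variable {R : Type u} [Ring R] {M : Type u} [AddCommGroup M] [Module Rᵐᵒᵖ M]
  [Module.Finite Rᵐᵒᵖ M] [Module.Projective Rᵐᵒᵖ M]

/-- The dual basis lemma for finitely generated projective right modules. -/
theorem exists_dual_basis (R : Type u) [Ring R] (M : Type u) [AddCommGroup M] [Module Rᵐᵒᵖ M]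
    [Module.Finite Rᵐᵒᵖ M] [Module.Projective Rᵐᵒᵖ M] :
    ∃ (n : ℕ) (m : Fin n → M) (φ : Fin n → (M →ₗ[Rᵐᵒᵖ] R)),
      ∀ x, ∑ k, MulOpposite.op (φ k x) • m k = x := by
  obtain ⟨n, p, s, -, -, hps⟩ := Module.Finite.exists_comp_eq_id_of_projective Rᵐᵒᵖ M
  refine ⟨n, fun k => p (Pi.single k 1), fun k =>
    (MulOpposite.opLinearEquiv Rᵐᵒᵖ : R ≃ₗ[Rᵐᵒᵖ] Rᵐᵒᵖ).symm.toLinearMap ∘ₗ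
      LinearMap.proj k ∘ₗ s, fun x => ?_⟩
  have h : ∑ k, (s x k) • (Pi.single k 1 : Fin n → Rᵐᵒᵖ) = s x := by
    ext l
    simp [Finset.sum_apply, Pi.single_apply]
  calc _ = p (∑ k, (s x k) • (Pi.single k 1 : Fin n → Rᵐᵒᵖ)) := by
        rw [map_sum]
        exact Finset.sum_congr rfl fun k _ => by rw [map_smul]; rfl
    _ = x := by rw [h]; exact LinearMap.congr_fun hps x

theorem eq_zero_of_forall_dual {x : M} (h : ∀ φ : M →ₗ[Rᵐᵒᵖ] R, φ x = 0) : x = 0 := by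
  obtain ⟨n, m, φ, hφ⟩ := exists_dual_basis R M
  rw [← hφ x]
  exact Finset.sum_eq_zero fun k _ => by rw [h, MulOpposite.op_zero, zero_smul]

/-- Surjectivity of `M → M**`: a dual basis expands `φ` as `∑ φ(m k) • χ k`, so `ψ` is evaluation at
`∑ ψ(χ k) m k`. -/
theorem exists_eq_eval (ψ : (M →ₗ[Rᵐᵒᵖ] R) →ₗ[R] R) : ∃ y : M, ∀ φ, ψ φ = φ y := by
  obtain ⟨n, m, χ, hχ⟩ := exists_dual_basis R M
  refine ⟨∑ k, MulOpposite.op (ψ (χ k)) • m k, fun φ => ?_⟩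
  have h : φ = ∑ k, φ (m k) • χ k := by
    ext x
    conv_lhs => rw [← hχ x]
    rw [map_sum, LinearMap.sum_apply]
    exact Finset.sum_congr rfl fun k _ => by
      rw [map_smul, op_smul_eq_mul, LinearMap.smul_apply, smul_eq_mul]
  conv_lhs => rw [h]
  rw [map_sum, map_sum]
  exact Finset.sum_congr rfl fun k _ => by
    rw [map_smul, map_smul, op_smul_eq_mul, smul_eq_mul]

/-- Evaluation at a point, as a linear form on the dual. -/
def evalAt (y : M) : (M →ₗ[Rᵐᵒᵖ] R) →ₗ[R] R where
  toFun φ := φ y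
  map_add' _ _ := rfl
  map_smul' _ _ := rfl

end Biduality

section Complex

variable {R : Type u} [Ring R] {K L : CochainComplex (FGProj Rᵐᵒᵖ) ℤ} (f : K ⟶ L)

instance (M : FGProj Rᵐᵒᵖ) : Module.Finite Rᵐᵒᵖ M.obj := M.property.1

instance (M : FGProj Rᵐᵒᵖ) : Module.Projective Rᵐᵒᵖ M.obj := M.property.2

/-- A cocycle of a dual complex is literally a linear form vanishing on boundaries, so the two
conditions differ only by the sign of the degree. -/
theorem cyclesSurj_dual_iff :
    CyclesSurj ((inclComplex R).map (dualComplexMap R f)) ↔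
      CocyclesExtend (ModuleCat.of Rᵐᵒᵖ R) ((inclComplex Rᵐᵒᵖ).map f) := by
  constructor
  · intro h i j hij φ hφ
    obtain ⟨i, rfl⟩ : ∃ k, i = -k := ⟨-i, by simp⟩
    obtain ⟨j, rfl⟩ : ∃ k, j = -k := ⟨-j, by simp⟩
    obtain ⟨y, hy, hyφ⟩ := h j i (by lia) φ.hom (congrArg ModuleCat.Hom.hom hφ)
    exact ⟨ModuleCat.ofHom y, ModuleCat.hom_ext hy, ModuleCat.hom_ext hyφ⟩
  · intro h i j hij x hx
    obtain ⟨ψ, hψ, hψx⟩ := h (-j) (-i) (by lia)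
      (ModuleCat.ofHom (show (K.X (-i)).obj →ₗ[Rᵐᵒᵖ] R from x)) (ModuleCat.hom_ext hx)
    exact ⟨ψ.hom, congrArg ModuleCat.Hom.hom hψ, congrArg ModuleCat.Hom.hom hψx⟩

/-- By biduality a linear form on a dual module is evaluation at a point, and linear forms separate
points; so the form vanishes on boundaries exactly when the point is a cocycle. -/
theorem cyclesSurj_iff_dual :
    CyclesSurj ((inclComplex Rᵐᵒᵖ).map f) ↔
      CocyclesExtend (ModuleCat.of R R) ((inclComplex R).map (dualComplexMap R f)) := by
  constructor
  · intro h i j hij φ hφ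
    obtain ⟨y, hy⟩ := exists_eq_eval (R := R) (M := (L.X (-j)).obj) φ.hom
    have hdy : (L.d (-j) (-i)).hom.hom y = 0 := by
      refine eq_zero_of_forall_dual (R := R) (M := (L.X (-i)).obj) fun χ => ?_
      have := LinearMap.congr_fun (congrArg ModuleCat.Hom.hom hφ) χ
      exact (hy (χ ∘ₗ (L.d (-j) (-i)).hom.hom)).symm.trans this
    obtain ⟨z, hz, hzy⟩ := h (-j) (-i) (by lia) y hdy
    refine ⟨ModuleCat.ofHom (evalAt (R := R) (M := (K.X (-j)).obj) z),
      ModuleCat.hom_ext (LinearMap.ext fun χ => ?_), ModuleCat.hom_ext (LinearMap.ext fun χ => ?_)⟩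
    · exact (congrArg (show (K.X (-i)).obj →ₗ[Rᵐᵒᵖ] R from χ) hz).trans (map_zero _)
    · exact (congrArg (show (L.X (-j)).obj →ₗ[Rᵐᵒᵖ] R from χ) hzy).trans (hy χ).symm
  · intro h i j hij x hx
    obtain ⟨i, rfl⟩ : ∃ k, i = -k := ⟨-i, by simp⟩
    obtain ⟨j, rfl⟩ : ∃ k, j = -k := ⟨-j, by simp⟩
    obtain ⟨ψ, hψ, hψx⟩ := h j i (by lia)
      (ModuleCat.ofHom (evalAt (R := R) (M := (L.X (-i)).obj) x))
      (ModuleCat.hom_ext (LinearMap.ext fun χ =>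
        (congrArg (show (L.X (-j)).obj →ₗ[Rᵐᵒᵖ] R from χ) hx).trans (map_zero _)))
    obtain ⟨y, hy⟩ := exists_eq_eval (R := R) (M := (K.X (-i)).obj) ψ.hom
    refine ⟨y, eq_zero_of_forall_dual (R := R) (M := (K.X (-j)).obj) fun χ => ?_, ?_⟩
    · exact (hy (χ ∘ₗ (K.d (-i) (-j)).hom.hom)).symm.trans
        (LinearMap.congr_fun (congrArg ModuleCat.Hom.hom hψ) χ)
    · rw [← sub_eq_zero]
      refine eq_zero_of_forall_dual (R := R) (M := (L.X (-i)).obj) fun χ => ?_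
      have h₁ := hy (χ ∘ₗ (f.f (-i)).hom.hom)
      have h₂ := LinearMap.congr_fun (congrArg ModuleCat.Hom.hom hψx) χ
      exact (map_sub χ _ _).trans (sub_eq_zero.2 (h₁.symm.trans h₂))

end Complex

section ShortExact

/-- The dual of a short complex of complexes. -/
@[simps] def dualShortComplex {R : Type u} [Ring R]
    (S : ShortComplex (CochainComplex (FGProj Rᵐᵒᵖ) ℤ)) :
    ShortComplex (CochainComplex (FGProj R) ℤ) where
  f := dualComplexMap R S.g
  g := dualComplexMap R S.f
  zero := by
    ext i : 1
    have h : S.f.f (-i) ≫ S.g.f (-i) = 0 := by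
      rw [← HomologicalComplex.comp_f, S.zero, HomologicalComplex.zero_f]
    have h' := congrArg (fun φ => (dualFunctor R).map (Quiver.Hom.op φ)) h
    simp only [op_comp, Functor.map_comp] at h'
    exact h'.trans ((dualFunctor R).map_zero _ _)

theorem shortExact_incl {A : Type u} [Ring A] (S : ShortComplex (CochainComplex (FGProj A) ℤ))
    (σ : ∀ n : ℤ, (S.map (HomologicalComplex.eval _ _ n)).Splitting) (i : ℤ) :
    ((S.map (inclComplex A)).map (HomologicalComplex.eval _ _ i)).ShortExact :=
  ((σ i).map (FGProj.incl A)).shortExact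

/-- The dual functor need not be exact, but being additive it preserves the degreewise splittings.
-/
theorem shortExact_incl_dual {R : Type u} [Ring R]
    (S : ShortComplex (CochainComplex (FGProj Rᵐᵒᵖ) ℤ))
    (σ : ∀ n : ℤ, (S.map (HomologicalComplex.eval _ _ n)).Splitting) (i : ℤ) :
    (((dualShortComplex S).map (inclComplex R)).map
      (HomologicalComplex.eval _ _ i)).ShortExact :=
  ((σ (-i)).op.map (dualFunctor R ⋙ FGProj.incl R)).shortExact

end ShortExact

/-! ### Passage to the homotopy category -/

section Homotopy

variable {A : Type u} [Ring A]

/-- The quotient functor to the homotopy category. -/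
abbrev toKProj (A : Type u) [Ring A] : CochainComplex (FGProj A) ℤ ⥤ KProj A :=
  HomotopyCategory.quotient _ _

/-- The cohomology functor, computed on complexes. -/
def cohomologyFactors (A : Type u) [Ring A] (i : ℤ) :
    toKProj A ⋙ cohomology A i ≅
      inclComplex A ⋙ HomologicalComplex.homologyFunctor _ _ i :=
  Functor.isoWhiskerLeft (inclComplex A) (HomotopyCategory.homologyFunctorFactors _ _ i)

theorem shortExact_iff_of_iso {X Y Z X' Y' Z' : ModuleCat.{u} A} {f : X ⟶ Y} {g : Y ⟶ Z}
    {f' : X' ⟶ Y'} {g' : Y' ⟶ Z'} (e₁ : X ≅ X') (e₂ : Y ≅ Y') (e₃ : Z ≅ Z')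
    (hf : f ≫ e₂.hom = e₁.hom ≫ f') (hg : g ≫ e₃.hom = e₂.hom ≫ g') :
    (Function.Injective f.hom ∧ Function.Exact f.hom g.hom ∧ Function.Surjective g.hom) ↔
      (Function.Injective f'.hom ∧ Function.Exact f'.hom g'.hom ∧
        Function.Surjective g'.hom) := by
  have c₁ : f'.hom ∘ₗ e₁.toLinearEquiv.toLinearMap = e₂.toLinearEquiv.toLinearMap ∘ₗ f.hom :=
    (congrArg ModuleCat.Hom.hom hf).symm
  have c₂ : g'.hom ∘ₗ e₂.toLinearEquiv.toLinearMap = e₃.toLinearEquiv.toLinearMap ∘ₗ g.hom :=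
    (congrArg ModuleCat.Hom.hom hg).symm
  have d₁ : f'.hom ∘ e₁.toLinearEquiv = e₂.toLinearEquiv ∘ f.hom := congrArg DFunLike.coe c₁
  have d₂ : g'.hom ∘ e₂.toLinearEquiv = e₃.toLinearEquiv ∘ g.hom := congrArg DFunLike.coe c₂
  refine and_congr ?_ (and_congr (Function.Exact.iff_of_ladder_linearEquiv c₁ c₂).symm ?_)
  · rw [← EquivLike.comp_injective f.hom e₂.toLinearEquiv, ← d₁, EquivLike.injective_comp]
  · rw [← EquivLike.comp_surjective g.hom e₃.toLinearEquiv, ← d₂, EquivLike.surjective_comp]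

theorem IsCohShortExact.of_iso {X Y Z X' Y' Z' : KProj A} {f : X ⟶ Y} {g : Y ⟶ Z}
    {f' : X' ⟶ Y'} {g' : Y' ⟶ Z'} (e₁ : X ≅ X') (e₂ : Y ≅ Y') (e₃ : Z ≅ Z')
    (hf : f ≫ e₂.hom = e₁.hom ≫ f') (hg : g ≫ e₃.hom = e₂.hom ≫ g')
    (h : IsCohShortExact f g) : IsCohShortExact f' g' := by
  intro i
  refine (shortExact_iff_of_iso ((cohomology A i).mapIso e₁) ((cohomology A i).mapIso e₂)
    ((cohomology A i).mapIso e₃) ?_ ?_).1 (h i)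
  · rw [Functor.mapIso_hom, Functor.mapIso_hom, ← Functor.map_comp, hf, Functor.map_comp]
  · rw [Functor.mapIso_hom, Functor.mapIso_hom, ← Functor.map_comp, hg, Functor.map_comp]

variable {K L M : CochainComplex (FGProj A) ℤ}

theorem isCohShortExact_toKProj_iff (f : K ⟶ L) (g : L ⟶ M) :
    IsCohShortExact ((toKProj A).map f) ((toKProj A).map g) ↔ ∀ i,
      Function.Injective (HomologicalComplex.homologyMap ((inclComplex A).map f) i).hom ∧
      Function.Exact (HomologicalComplex.homologyMap ((inclComplex A).map f) i).hom
        (HomologicalComplex.homologyMap ((inclComplex A).map g) i).hom ∧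
      Function.Surjective (HomologicalComplex.homologyMap ((inclComplex A).map g) i).hom :=
  forall_congr' fun i => shortExact_iff_of_iso ((cohomologyFactors A i).app K)
    ((cohomologyFactors A i).app L) ((cohomologyFactors A i).app M)
    ((cohomologyFactors A i).hom.naturality f) ((cohomologyFactors A i).hom.naturality g)

theorem epi_cohomology_map_iff (f : K ⟶ L) (i : ℤ) :
    Epi ((cohomology A i).map ((toKProj A).map f)) ↔
      Epi (HomologicalComplex.homologyMap ((inclComplex A).map f) i) :=
  (MorphismProperty.epimorphisms _).arrow_mk_iso_iff
    (Arrow.isoMk ((cohomologyFactors A i).app K) ((cohomologyFactors A i).app L)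
      ((cohomologyFactors A i).hom.naturality f).symm)

theorem CyclesSurj.epi_cohomology_map {f : K ⟶ L} (hf : CyclesSurj ((inclComplex A).map f))
    (i : ℤ) : Epi ((cohomology A i).map ((toKProj A).map f)) :=
  (epi_cohomology_map_iff f i).2 ((ModuleCat.epi_iff_surjective _).2 (hf.homologyMap_surjective i))

theorem isCohShortExact_of_cyclesSurj (S : ShortComplex (CochainComplex (FGProj A) ℤ))
    (hS : ∀ i, ((S.map (inclComplex A)).map (HomologicalComplex.eval _ _ i)).ShortExact)
    (hg : CyclesSurj ((inclComplex A).map S.g)) :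
    IsCohShortExact ((toKProj A).map S.f) ((toKProj A).map S.g) :=
  (isCohShortExact_toKProj_iff _ _).2 (shortExact_homology hS hg)

theorem cyclesSurj_of_epi (S : ShortComplex (CochainComplex (FGProj A) ℤ))
    (hS : ∀ i, ((S.map (inclComplex A)).map (HomologicalComplex.eval _ _ i)).ShortExact)
    (h : ∀ i, Epi ((cohomology A i).map ((toKProj A).map S.g))) :
    CyclesSurj ((inclComplex A).map S.g) :=
  .of_homologyMap (fun i => (hS i).moduleCat_surjective_g)
    fun i => (ModuleCat.epi_iff_surjective _).1 ((epi_cohomology_map_iff _ _).1 (h i))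

theorem epi_cohomology_map_of_iso {X Y X' Y' : KProj A} {f : X ⟶ Y} {f' : X' ⟶ Y'}
    (e₁ : X ≅ X') (e₂ : Y ≅ Y') (hf : f ≫ e₂.hom = e₁.hom ≫ f') {i : ℤ}
    (h : Epi ((cohomology A i).map f)) : Epi ((cohomology A i).map f') := by
  rw [← Iso.inv_comp_eq] at hf
  rw [← hf, Functor.map_comp, Functor.map_comp]
  infer_instance

theorem IsCohShortExact.epi {X Y Z : KProj A} {f : X ⟶ Y} {g : Y ⟶ Z} (h : IsCohShortExact f g)
    (i : ℤ) : Epi ((cohomology A i).map g) :=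
  (ModuleCat.epi_iff_surjective _).2 (h i).2.2

/-- A retraction in the homotopy category lifts to chain maps whose composite is homotopic to the
identity. In particular the vanishing condition is invariant under isomorphism in `KProj A`. -/
theorem CokerExtVanishAt.of_retract {N : ModuleCat.{u} A} {j : ℕ} (hj : 0 < j) {X Y : KProj A}
    (r : Retract X Y) (h : CokerExtVanishAt N j (toComplex Y)) :
    CokerExtVanishAt N j (toComplex X) := by
  obtain ⟨f, hf⟩ := (toKProj A).map_surjective (X := X.as) (Y := Y.as) r.i
  obtain ⟨g, hg⟩ := (toKProj A).map_surjective (X := Y.as) (Y := X.as) r.r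
  have hfg : (toKProj A).map (𝟙 X.as) = (toKProj A).map (f ≫ g) := by
    rw [Functor.map_comp, hf, hg]
    exact ((toKProj A).map_id _).trans r.retract.symm
  have H := (FGProj.incl A).mapHomotopy (HomotopyCategory.homotopyOfEq _ _ hfg)
  exact CokerExtVanishAt.of_homotopy hj ((inclComplex A).map f) ((inclComplex A).map g)
    ((Homotopy.ofEq ((inclComplex A).map_id _).symm).trans (H.trans (Homotopy.ofEq
      (Functor.map_comp _ _ _)))) (fun i => (X.as.X i).property.2) h

theorem CokerExtVanish.of_retract {N : ModuleCat.{u} A} {X Y : KProj A} (r : Retract X Y)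
    (h : CokerExtVanish N (toComplex Y)) : CokerExtVanish N (toComplex X) :=
  fun i j hj => CokerExtVanishAt.of_retract hj r (fun i => h i j hj) i

end Homotopy

section Gorenstein

variable {R : Type u} [Ring R]

theorem isGorensteinProjective_iff (X : KProj Rᵐᵒᵖ) :
    IsGorensteinProjective X ↔ CokerExtVanish (ModuleCat.of Rᵐᵒᵖ R) (toComplex X) ∧
      CokerExtVanish (ModuleCat.of R R) (toComplex (dualObj X)) :=
  ⟨fun h => ⟨fun i j hj => (h i j hj).1, fun i j hj => (h i j hj).2⟩,
    fun h i j hj => ⟨h.1 i j hj, h.2 i j hj⟩⟩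

/-- The dual of a retract. -/
def dualRetract {X Y : KProj Rᵐᵒᵖ} (r : Retract X Y) : Retract (dualObj X) (dualObj Y) where
  i := dualMap r.r
  r := dualMap r.i
  retract := by
    rw [← unop_comp, ← Functor.map_comp, r.retract, CategoryTheory.Functor.map_id, unop_id]

theorem IsGorensteinProjective.of_retract {X Y : KProj Rᵐᵒᵖ} (r : Retract X Y)
    (h : IsGorensteinProjective Y) : IsGorensteinProjective X := by
  rw [isGorensteinProjective_iff] at h ⊢
  exact ⟨h.1.of_retract r, h.2.of_retract (dualRetract r)⟩

theorem IsGorensteinProjective.of_iso {X Y : KProj Rᵐᵒᵖ} (e : X ≅ Y)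
    (h : IsGorensteinProjective X) : IsGorensteinProjective Y :=
  h.of_retract (.ofIso e.symm)

end Gorenstein

/-! ### Cohomologically ghost triangles and Gorenstein projectivity -/

section Model

variable {A : Type u} [Ring A]

/-- A presentation of a diagram `X ⟶ Y ⟶ Z` in the homotopy category by a degreewise split short
exact sequence of complexes. -/
structure SplitModel {X Y Z : KProj A} (f : X ⟶ Y) (g : Y ⟶ Z) where
  /-- the short exact sequence -/
  S : ShortComplex (CochainComplex (FGProj A) ℤ)
  /-- the splittings -/
  σ : ∀ n : ℤ, (S.map (HomologicalComplex.eval _ _ n)).Splitting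
  /-- the comparison of the first terms -/
  e₁ : X ≅ (toKProj A).obj S.X₁
  /-- the comparison of the second terms -/
  e₂ : Y ≅ (toKProj A).obj S.X₂
  /-- the comparison of the third terms -/
  e₃ : Z ≅ (toKProj A).obj S.X₃
  comm_f : f ≫ e₂.hom = e₁.hom ≫ (toKProj A).map S.f
  comm_g : g ≫ e₃.hom = e₂.hom ≫ (toKProj A).map S.g

theorem nonempty_splitModel {X Y Z : KProj A} {f : X ⟶ Y} {g : Y ⟶ Z}
    {h : Z ⟶ (shiftFunctor (KProj A) (1 : ℤ)).obj X}
    (hT : Triangle.mk f g h ∈ distTriang (KProj A)) : Nonempty (SplitModel f g) := by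
  obtain ⟨S, σ, ⟨e⟩⟩ :=
    (HomotopyCategory.distinguished_iff_iso_trianglehOfDegreewiseSplit _).1 hT
  exact ⟨⟨S, σ, Triangle.π₁.mapIso e, Triangle.π₂.mapIso e, Triangle.π₃.mapIso e,
    e.hom.comm₁, e.hom.comm₂⟩⟩

variable {X Y Z : KProj A} {f : X ⟶ Y} {g : Y ⟶ Z}

theorem SplitModel.cyclesSurj (M : SplitModel f g) (h : ∀ i, Epi ((cohomology A i).map g)) :
    CyclesSurj ((inclComplex A).map M.S.g) :=
  cyclesSurj_of_epi _ (shortExact_incl M.S M.σ)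
    fun i => epi_cohomology_map_of_iso M.e₂ M.e₃ M.comm_g (h i)

theorem SplitModel.isCohShortExact (M : SplitModel f g)
    (h : CyclesSurj ((inclComplex A).map M.S.g)) : IsCohShortExact f g := by
  refine (isCohShortExact_of_cyclesSurj _ (shortExact_incl M.S M.σ) h).of_iso
    M.e₁.symm M.e₂.symm M.e₃.symm ?_ ?_
  · rw [Iso.symm_hom, Iso.symm_hom, Iso.comp_inv_eq, Category.assoc, Iso.eq_inv_comp, M.comm_f]
  · rw [Iso.symm_hom, Iso.symm_hom, Iso.comp_inv_eq, Category.assoc, Iso.eq_inv_comp, M.comm_g]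

end Model

/-! ### Dual triangles, and closure of Gorenstein projectives in ghost triangles -/

section Dual

variable {R : Type u} [Ring R] {X Y Z : KProj Rᵐᵒᵖ} {f : X ⟶ Y} {g : Y ⟶ Z}

theorem comp_inv_eq_inv_comp {C : Type*} [Category* C] {a b c d : C} {e : a ≅ b} {e' : c ≅ d}
    {p : b ⟶ d} {q : a ⟶ c} (h : e.hom ≫ p = q ≫ e'.hom) : p ≫ e'.inv = e.inv ≫ q := by
  rw [Iso.comp_inv_eq, Category.assoc, Iso.eq_inv_comp, h]

/-- The isomorphism induced on duals. -/
def dualIso (e : X ≅ Y) : dualObj Y ≅ dualObj X := ((dual R).mapIso e).unop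

theorem dualMap_comp (f : X ⟶ Y) (g : Y ⟶ Z) : dualMap (f ≫ g) = dualMap g ≫ dualMap f := by
  rw [dualMap, Functor.map_comp, unop_comp]

theorem SplitModel.dual_comm_f (M : SplitModel f g) :
    (dualIso M.e₂).hom ≫ dualMap f =
      (toKProj R).map (dualComplexMap R M.S.f) ≫ (dualIso M.e₁).hom := by
  have h := congrArg dualMap M.comm_f
  rwa [dualMap_comp, dualMap_comp] at h

theorem SplitModel.dual_comm_g (M : SplitModel f g) :
    (dualIso M.e₃).hom ≫ dualMap g =
      (toKProj R).map (dualComplexMap R M.S.g) ≫ (dualIso M.e₂).hom := by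
  have h := congrArg dualMap M.comm_g
  rwa [dualMap_comp, dualMap_comp] at h

theorem SplitModel.cyclesSurj_dual (M : SplitModel f g)
    (h : ∀ i, Epi ((cohomology R i).map (dualMap f))) :
    CyclesSurj ((inclComplex R).map (dualComplexMap R M.S.f)) :=
  cyclesSurj_of_epi (dualShortComplex M.S) (shortExact_incl_dual M.S M.σ)
    fun i => epi_cohomology_map_of_iso (dualIso M.e₂).symm (dualIso M.e₁).symm
      (comp_inv_eq_inv_comp M.dual_comm_f) (h i)

theorem SplitModel.isCohShortExact_dual (M : SplitModel f g)
    (h : CyclesSurj ((inclComplex R).map (dualComplexMap R M.S.f))) :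
    IsCohShortExact (dualMap g) (dualMap f) :=
  (isCohShortExact_of_cyclesSurj (dualShortComplex M.S) (shortExact_incl_dual M.S M.σ) h).of_iso
    (dualIso M.e₃) (dualIso M.e₂) (dualIso M.e₁) M.dual_comm_g.symm M.dual_comm_f.symm

theorem isGorensteinProjective_toKProj_iff (K : CochainComplex (FGProj Rᵐᵒᵖ) ℤ) :
    IsGorensteinProjective ((toKProj Rᵐᵒᵖ).obj K) ↔
      CokerExtVanish (ModuleCat.of Rᵐᵒᵖ R) ((inclComplex Rᵐᵒᵖ).obj K) ∧
      CokerExtVanish (ModuleCat.of R R) ((inclComplex R).obj (dualComplex R K)) :=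
  isGorensteinProjective_iff _

variable {h : Z ⟶ (shiftFunctor (KProj Rᵐᵒᵖ) (1 : ℤ)).obj X}

/-- If the last two terms of a distinguished triangle are Gorenstein projective and the map between
them is surjective on cohomology, then the triangle and its dual are cohomologically ghost and the
first term is Gorenstein projective. -/
theorem IsGorensteinProjective.first (hT : Triangle.mk f g h ∈ distTriang (KProj Rᵐᵒᵖ))
    (hg : ∀ i, Epi ((cohomology Rᵐᵒᵖ i).map g))
    (hY : IsGorensteinProjective Y) (hZ : IsGorensteinProjective Z) :
    IsCohShortExact f g ∧ IsCohShortExact (dualMap g) (dualMap f) ∧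
      IsGorensteinProjective X := by
  obtain ⟨M⟩ := nonempty_splitModel hT
  replace hg := M.cyclesSurj hg
  obtain ⟨hY₁, hY₂⟩ := (isGorensteinProjective_toKProj_iff _).1 (hY.of_iso M.e₂)
  obtain ⟨hZ₁, hZ₂⟩ := (isGorensteinProjective_toKProj_iff _).1 (hZ.of_iso M.e₃)
  have hS := shortExact_incl M.S M.σ
  have hS' := shortExact_incl_dual M.S M.σ
  -- `Ext¹(Cⁱ(Z), R) = 0` extends every form on `Cⁱ(X)` to `Cⁱ(Y)`, which is surjectivity on
  -- cocycles for the dual of `f`.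
  have hf : CyclesSurj ((inclComplex R).map (dualComplexMap R M.S.f)) :=
    (cyclesSurj_dual_iff _).2 (CocyclesExtend.of_cokerExtVanish (S := M.S.map (inclComplex Rᵐᵒᵖ)) hS hg hZ₁)
  refine ⟨M.isCohShortExact hg, M.isCohShortExact_dual hf,
    IsGorensteinProjective.of_iso M.e₁.symm
    ((isGorensteinProjective_toKProj_iff _).2 ⟨CokerExtVanish.first (S := M.S.map (inclComplex Rᵐᵒᵖ)) hS hg hY₁ hZ₁, ?_⟩)⟩
  -- In the dual sequence `Z* → Y* → X*` the sought complex comes last, so `Ext¹` needs forms to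
  -- extend; biduality turns this into `hg`.
  exact CokerExtVanish.third (S := (dualShortComplex M.S).map (inclComplex R)) hS' hf ((cyclesSurj_iff_dual _).1 hg) hZ₂ hY₂

/-- If the first two terms of a distinguished triangle are Gorenstein projective and the dual of the
map between them is surjective on cohomology, then the triangle and its dual are cohomologically
ghost and the third term is Gorenstein projective. -/
theorem IsGorensteinProjective.third (hT : Triangle.mk f g h ∈ distTriang (KProj Rᵐᵒᵖ))
    (hf : ∀ i, Epi ((cohomology R i).map (dualMap f)))
    (hX : IsGorensteinProjective X) (hY : IsGorensteinProjective Y) :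
    IsCohShortExact f g ∧ IsCohShortExact (dualMap g) (dualMap f) ∧
      IsGorensteinProjective Z := by
  obtain ⟨M⟩ := nonempty_splitModel hT
  replace hf := M.cyclesSurj_dual hf
  obtain ⟨hX₁, hX₂⟩ := (isGorensteinProjective_toKProj_iff _).1 (hX.of_iso M.e₁)
  obtain ⟨hY₁, hY₂⟩ := (isGorensteinProjective_toKProj_iff _).1 (hY.of_iso M.e₂)
  have hS := shortExact_incl M.S M.σ
  have hS' := shortExact_incl_dual M.S M.σ
  have hg : CyclesSurj ((inclComplex Rᵐᵒᵖ).map M.S.g) :=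
    (cyclesSurj_iff_dual _).2 (CocyclesExtend.of_cokerExtVanish (S := (dualShortComplex M.S).map (inclComplex R)) hS' hf hX₂)
  refine ⟨M.isCohShortExact hg, M.isCohShortExact_dual hf,
    IsGorensteinProjective.of_iso M.e₃.symm
    ((isGorensteinProjective_toKProj_iff _).2 ⟨?_, CokerExtVanish.first (S := (dualShortComplex M.S).map (inclComplex R)) hS' hf hY₂ hX₂⟩)⟩
  exact CokerExtVanish.third (S := M.S.map (inclComplex Rᵐᵒᵖ)) hS hg ((cyclesSurj_dual_iff _).1 hf) hX₁ hY₁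

theorem cokerExtVanishAt_of_iso {A : Type u} [Ring A] {N : ModuleCat.{u} A} {j : ℕ} (hj : 0 < j)
    {X Y : KProj A} (e : X ≅ Y) (h : CokerExtVanishAt N j (toComplex X)) :
    CokerExtVanishAt N j (toComplex Y) :=
  h.of_retract hj (.ofIso e.symm)

/-- The vanishing of `Ext` in one degree more for the third term, and dually for the first. -/
theorem cokerExtVanishAt_of_ghost (hT : IsCohGhost (Triangle.mk f g h))
    (hd : IsCohShortExact (dualMap g) (dualMap f)) (hY : IsGorensteinProjective Y) :
    CokerExtVanishAt (ModuleCat.of Rᵐᵒᵖ R) 1 (toComplex Z) ∧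
      CokerExtVanishAt (ModuleCat.of R R) 1 (toComplex (dualObj X)) ∧
      ∀ j, 0 < j →
        (CokerExtVanishAt (ModuleCat.of Rᵐᵒᵖ R) j (toComplex X) →
          CokerExtVanishAt (ModuleCat.of Rᵐᵒᵖ R) (j + 1) (toComplex Z)) ∧
        (CokerExtVanishAt (ModuleCat.of R R) j (toComplex (dualObj Z)) →
          CokerExtVanishAt (ModuleCat.of R R) (j + 1) (toComplex (dualObj X))) := by
  obtain ⟨M⟩ := nonempty_splitModel hT.1
  have hg := M.cyclesSurj hT.2.epi
  have hf := M.cyclesSurj_dual hd.epi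
  obtain ⟨hY₁, hY₂⟩ := (isGorensteinProjective_toKProj_iff _).1 (hY.of_iso M.e₂)
  have hS := shortExact_incl M.S M.σ
  have hS' := shortExact_incl_dual M.S M.σ
  have h₁ : CokerExtVanishAt (ModuleCat.of Rᵐᵒᵖ R) 1 ((inclComplex Rᵐᵒᵖ).obj M.S.X₃) :=
    CokerExtVanishAt.third_one (S := M.S.map (inclComplex Rᵐᵒᵖ)) hS hg
      ((cyclesSurj_dual_iff _).1 hf) hY₁
  have h₂ : CokerExtVanishAt (ModuleCat.of R R) 1 ((inclComplex R).obj (dualComplex R M.S.X₁)) :=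
    CokerExtVanishAt.third_one (S := (dualShortComplex M.S).map (inclComplex R)) hS' hf
      ((cyclesSurj_iff_dual _).1 hg) hY₂
  have h₃ (j : ℕ) (H : CokerExtVanishAt (ModuleCat.of Rᵐᵒᵖ R) j ((inclComplex Rᵐᵒᵖ).obj M.S.X₁)) :
      CokerExtVanishAt (ModuleCat.of Rᵐᵒᵖ R) (j + 1) ((inclComplex Rᵐᵒᵖ).obj M.S.X₃) :=
    CokerExtVanishAt.third_succ (S := M.S.map (inclComplex Rᵐᵒᵖ)) hS hg H hY₁
  have h₄ (j : ℕ)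
      (H : CokerExtVanishAt (ModuleCat.of R R) j ((inclComplex R).obj (dualComplex R M.S.X₃))) :
      CokerExtVanishAt (ModuleCat.of R R) (j + 1)
        ((inclComplex R).obj (dualComplex R M.S.X₁)) :=
    CokerExtVanishAt.third_succ (S := (dualShortComplex M.S).map (inclComplex R)) hS' hf H hY₂
  have k₁ : CokerExtVanishAt (ModuleCat.of Rᵐᵒᵖ R) 1 (toComplex Z) :=
    cokerExtVanishAt_of_iso one_pos M.e₃.symm h₁
  have k₂ : CokerExtVanishAt (ModuleCat.of R R) 1 (toComplex (dualObj X)) :=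
    cokerExtVanishAt_of_iso one_pos (dualIso M.e₁) h₂
  have k₃ (j : ℕ) (hj : 0 < j) (H : CokerExtVanishAt (ModuleCat.of Rᵐᵒᵖ R) j (toComplex X)) :
      CokerExtVanishAt (ModuleCat.of Rᵐᵒᵖ R) (j + 1) (toComplex Z) := by
    have hj' : 0 < j + 1 := j.succ_pos
    have H' : CokerExtVanishAt (ModuleCat.of Rᵐᵒᵖ R) j (toComplex ((toKProj Rᵐᵒᵖ).obj M.S.X₁)) :=
      cokerExtVanishAt_of_iso hj M.e₁ H
    exact cokerExtVanishAt_of_iso hj' M.e₃.symm (h₃ j H')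
  have k₄ (j : ℕ) (hj : 0 < j) (H : CokerExtVanishAt (ModuleCat.of R R) j (toComplex (dualObj Z))) :
      CokerExtVanishAt (ModuleCat.of R R) (j + 1) (toComplex (dualObj X)) := by
    have hj' : 0 < j + 1 := j.succ_pos
    have H' : CokerExtVanishAt (ModuleCat.of R R) j
        (toComplex (dualObj ((toKProj Rᵐᵒᵖ).obj M.S.X₃))) :=
      cokerExtVanishAt_of_iso hj (dualIso M.e₃).symm H
    exact cokerExtVanishAt_of_iso hj' (dualIso M.e₁) (h₄ j H')
  exact ⟨k₁, k₂, fun j hj => ⟨k₃ j hj, k₄ j hj⟩⟩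

/-- A two-sided ghost resolution by Gorenstein projectives has Gorenstein projective terms. -/
theorem isGorensteinProjective_of_resolution {Y G : ℤ → KProj Rᵐᵒᵖ} {f : ∀ t, Y (t + 1) ⟶ G t}
    {g : ∀ t, G t ⟶ Y t} {h : ∀ t, Y t ⟶ (shiftFunctor (KProj Rᵐᵒᵖ) (1 : ℤ)).obj (Y (t + 1))}
    (H : ∀ t, IsGorensteinProjective (G t) ∧ IsCohGhost (Triangle.mk (f t) (g t) (h t)) ∧
      IsCohShortExact (dualMap (g t)) (dualMap (f t))) (t : ℤ) :
    IsGorensteinProjective (Y t) := by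
  have key := fun t => cokerExtVanishAt_of_ghost (H t).2.1 (H t).2.2 (H t).1
  have h₁ : ∀ (j : ℕ) t, CokerExtVanishAt (ModuleCat.of Rᵐᵒᵖ R) (j + 1) (toComplex (Y t)) := by
    intro j
    induction j with
    | zero => exact fun t => (key t).1
    | succ j ih => exact fun t => ((key t).2.2 (j + 1) j.succ_pos).1 (ih _)
  -- For the duals, vanishing passes from `Y t` to `Y (t + 1)`, so the inductive step uses the
  -- triangle before the current one.
  have h₂ : ∀ (j : ℕ) t,
      CokerExtVanishAt (ModuleCat.of R R) (j + 1) (toComplex (dualObj (Y (t + 1)))) := by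
    intro j
    induction j with
    | zero => exact fun t => (key t).2.1
    | succ j ih =>
      intro t
      have := ih (t - 1)
      rw [sub_add_cancel] at this
      exact ((key t).2.2 (j + 1) j.succ_pos).2 this
  refine (isGorensteinProjective_iff _).2 ⟨fun i j hj => ?_, fun i j hj => ?_⟩
  · obtain ⟨j, rfl⟩ := Nat.exists_eq_succ_of_ne_zero hj.ne'
    exact h₁ j t i
  · obtain ⟨j, rfl⟩ := Nat.exists_eq_succ_of_ne_zero hj.ne'
    have := h₂ j (t - 1) i
    rwa [sub_add_cancel] at this

end Dual

/-! ### Complexes with zero differential -/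

section ZeroDiff

variable {A : Type u} [Ring A]

/-- The complex with zero differential and given terms. -/
@[simps] def zeroDiff (M : ℤ → FGProj A) : CochainComplex (FGProj A) ℤ where
  X := M
  d _ _ := 0

theorem CokerExtVanish.of_d_eq_zero {N : ModuleCat.{u} A} {K : CochainComplex (FGProj A) ℤ}
    (hK : ∀ i j, K.d i j = 0) : CokerExtVanish N ((inclComplex A).obj K) := by
  intro i
  apply ExtVanish.of_projective
  have h : ((inclComplex A).obj K).d (i - 1) i = 0 := by
    change (FGProj.incl A).map (K.d (i - 1) i) = 0
    rw [hK, Functor.map_zero]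
  have : IsIso (cokernel.π (((inclComplex A).obj K).d (i - 1) i)) := by
    rw [h]
    infer_instance
  have : Module.Projective A (((inclComplex A).obj K).X i) := (K.X i).property.2
  exact Module.Projective.of_equiv
    (asIso (cokernel.π (((inclComplex A).obj K).d (i - 1) i))).toLinearEquiv

theorem isGorensteinProjective_zeroDiff {R : Type u} [Ring R] (M : ℤ → FGProj Rᵐᵒᵖ) :
    IsGorensteinProjective ((toKProj Rᵐᵒᵖ).obj (zeroDiff M)) :=
  (isGorensteinProjective_toKProj_iff _).2 ⟨.of_d_eq_zero fun _ _ => rfl,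
    .of_d_eq_zero fun _ _ => (dualFunctor R).map_zero _ _⟩

theorem exists_zeroDiff_cover [IsNoetherianRing A] (X : CochainComplex (FGProj A) ℤ) :
    ∃ (M : ℤ → FGProj A) (π : zeroDiff M ⟶ X), CyclesSurj ((inclComplex A).map π) := by
  have key (i : ℤ) : ∃ (M : FGProj A) (p : M ⟶ X.X i), p ≫ X.d i (i + 1) = 0 ∧
      ∀ x : (X.X i).obj, (X.d i (i + 1)).hom.hom x = 0 → ∃ y : M.obj, p.hom.hom y = x := by
    have : Module.Finite A (X.X i).obj := (X.X i).property.1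
    -- The module of cocycles is finitely generated because `A` is noetherian.
    obtain ⟨n, p, hp⟩ := Module.Finite.exists_fin' A (LinearMap.ker (X.d i (i + 1)).hom.hom)
    refine ⟨⟨ModuleCat.of A (Fin n → A), inferInstanceAs (Module.Finite A (Fin n → A)),
      inferInstanceAs (Module.Projective A (Fin n → A))⟩,
      ObjectProperty.homMk (ModuleCat.ofHom ((Submodule.subtype _).comp p)), ?_, fun x hx => ?_⟩
    · apply ObjectProperty.hom_ext
      exact ModuleCat.hom_ext (LinearMap.ext fun y => (p y).2)
    · obtain ⟨y, hy⟩ := hp ⟨x, hx⟩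
      exact ⟨y, congrArg Subtype.val hy⟩
  choose M p hp hp' using key
  refine ⟨M, { f := p, comm' := ?_ }, ?_⟩
  · rintro i j rfl
    exact (hp i).trans zero_comp.symm
  · rintro i j rfl x hx
    obtain ⟨y, hy⟩ := hp' i x hx
    exact ⟨y, rfl, hy⟩

/-- A chain map out of a complex with zero differential lands in cocycles, so it lifts degree by
degree by projectivity; with both differentials zero, any family of lifts is a chain map. -/
theorem exists_lift_of_cyclesSurj {W X : CochainComplex (FGProj A) ℤ} {M : ℤ → FGProj A}
    (hW : ∀ i j, W.d i j = 0) (π : zeroDiff M ⟶ X) (hπ : CyclesSurj ((inclComplex A).map π))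
    (v : W ⟶ X) : ∃ w : W ⟶ zeroDiff M, w ≫ π = v := by
  have key (i : ℤ) : ∃ w : W.X i ⟶ M i, w ≫ π.f i = v.f i := by
    have hP : Module.Projective A (W.X i).obj := (W.X i).property.2
    let Z := LinearMap.ker (X.d i (i + 1)).hom.hom
    have hπ₀ : ∀ y, (π.f i).hom.hom y ∈ Z := fun y => by
      have h : π.f i ≫ X.d i (i + 1) = 0 := (π.comm i (i + 1)).trans zero_comp
      exact congrArg (fun f => f.hom.hom y) h
    have hv₀ : ∀ y, (v.f i).hom.hom y ∈ Z := fun y => by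
      have h : v.f i ≫ X.d i (i + 1) = 0 := by rw [v.comm, hW, zero_comp]
      exact congrArg (fun f => f.hom.hom y) h
    obtain ⟨w, hw⟩ := Module.projective_lifting_property
      (LinearMap.codRestrict Z (π.f i).hom.hom hπ₀) (LinearMap.codRestrict Z (v.f i).hom.hom hv₀)
      (fun z => by
        obtain ⟨y, -, hy⟩ := hπ i (i + 1) rfl z.1 z.2
        exact ⟨y, Subtype.ext hy⟩)
    refine ⟨ObjectProperty.homMk (ModuleCat.ofHom w), ?_⟩
    apply ObjectProperty.hom_ext
    exact ModuleCat.hom_ext (LinearMap.ext fun y =>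
      congrArg Subtype.val (LinearMap.congr_fun hw y))
  choose w hw using key
  refine ⟨{ f := w, comm' := fun i j _ => ?_ }, ?_⟩
  · rw [hW]
    exact comp_zero.trans zero_comp.symm
  · ext i : 1
    exact hw i

end ZeroDiff

/-! ### Maps to complexes with zero differential that are onto dual cocycles -/

section DualCover

variable {R : Type u} [Ring R]

theorem isFGProj_fin_fun (R : Type u) [Ring R] (n : ℕ) :
    isFGProj Rᵐᵒᵖ (ModuleCat.of Rᵐᵒᵖ (Fin n → R)) := by
  let e : (Fin n → R) ≃ₗ[Rᵐᵒᵖ] (Fin n → Rᵐᵒᵖ) :=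
    LinearEquiv.piCongrRight fun _ => MulOpposite.opLinearEquiv Rᵐᵒᵖ
  exact ⟨Module.Finite.equiv e.symm, Module.Projective.of_equiv e.symm⟩

/-- The right module of row vectors. -/
def freeRight (R : Type u) [Ring R] (n : ℕ) : FGProj Rᵐᵒᵖ := ⟨_, isFGProj_fin_fun R n⟩

theorem exists_zeroDiff_hull [IsNoetherianRing R] (X : CochainComplex (FGProj Rᵐᵒᵖ) ℤ) :
    ∃ (M : ℤ → FGProj Rᵐᵒᵖ) (ι : X ⟶ zeroDiff M),
      CyclesSurj ((inclComplex R).map (dualComplexMap R ι)) := by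
  have key (i : ℤ) : ∃ (n : ℕ) (q : X.X i ⟶ freeRight R n), X.d (i - 1) i ≫ q = 0 ∧
      ∀ φ : (X.X i).obj →ₗ[Rᵐᵒᵖ] R, φ ∘ₗ (X.d (i - 1) i).hom.hom = 0 →
        ∃ ψ : (Fin n → R) →ₗ[Rᵐᵒᵖ] R, ψ ∘ₗ q.hom.hom = φ := by
    have : Module.Finite R ((X.X i).obj →ₗ[Rᵐᵒᵖ] R) := (isFGProj_dual R _ (X.X i).property).1
    let W : Submodule R ((X.X i).obj →ₗ[Rᵐᵒᵖ] R) :=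
      { carrier := { φ | φ ∘ₗ (X.d (i - 1) i).hom.hom = 0 }
        add_mem' := fun {a b} (ha : a ∘ₗ _ = 0) (hb : b ∘ₗ _ = 0) => by
          change (a + b) ∘ₗ _ = 0
          rw [LinearMap.add_comp, ha, hb, add_zero]
        zero_mem' := LinearMap.zero_comp _
        smul_mem' := fun c a (ha : a ∘ₗ _ = 0) => by
          change (c • a) ∘ₗ _ = 0
          rw [LinearMap.smul_comp, ha, smul_zero] }
    -- `W` is the left module of dual cocycles. Its finitely many generators become the coordinates
    -- of a map to `Rⁿ`, through which every dual cocycle factors.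
    obtain ⟨n, s, hs⟩ := Submodule.fg_iff_exists_fin_generating_family.1
      (IsNoetherian.noetherian W)
    have hsW : ∀ k, s k ∘ₗ (X.d (i - 1) i).hom.hom = 0 := fun k => by
      have : s k ∈ W := hs ▸ Submodule.subset_span ⟨k, rfl⟩
      exact this
    refine ⟨n, ObjectProperty.homMk (ModuleCat.ofHom (LinearMap.pi s)), ?_, fun φ hφ => ?_⟩
    · apply ObjectProperty.hom_ext
      exact ModuleCat.hom_ext (LinearMap.ext fun x => funext fun k => LinearMap.congr_fun (hsW k) x)
    · have : φ ∈ Submodule.span R (Set.range s) := hs ▸ hφ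
      obtain ⟨c, rfl⟩ := (Submodule.mem_span_range_iff_exists_fun R).1 this
      refine ⟨∑ k, c k • LinearMap.proj k, LinearMap.ext fun x => ?_⟩
      change (∑ k, c k • (LinearMap.proj k : (Fin n → R) →ₗ[Rᵐᵒᵖ] R)) (LinearMap.pi s x) = _
      rw [LinearMap.sum_apply, LinearMap.sum_apply]
      rfl
  choose n q hq hq' using key
  let ι : X ⟶ zeroDiff fun i => freeRight R (n i) :=
    { f := q
      comm' := by
        rintro i j rfl
        have : X.d i (i + 1) ≫ q (i + 1) = 0 := by
          have := hq (i + 1)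
          rwa [add_sub_cancel_right] at this
        exact (comp_zero).trans this.symm }
  refine ⟨_, ι, (cyclesSurj_dual_iff ι).2 ?_⟩
  intro i j hij φ hφ
  obtain rfl : i = j - 1 := by lia
  obtain ⟨ψ, hψ⟩ := hq' j φ.hom (congrArg ModuleCat.Hom.hom hφ)
  exact ⟨ModuleCat.ofHom ψ, zero_comp, ModuleCat.hom_ext hψ⟩

end DualCover

/-! ### Split complexes -/

section Coproduct

variable {A : Type u} [Ring A] {J : Type u} {F : J → CochainComplex (FGProj A) ℤ}
  {W : CochainComplex (FGProj A) ℤ}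

/-- A degreewise coproduct of complexes with zero differential is a coproduct in the homotopy
category. -/
theorem nonempty_isColimit_of_degreewise (hF : ∀ j k l, (F j).d k l = 0)
    (hW : ∀ k l, W.d k l = 0) (ι : ∀ j, F j ⟶ W)
    (hdesc : ∀ (k : ℤ) (Z : FGProj A) (φ : ∀ j, (F j).X k ⟶ Z),
      ∃ ψ : W.X k ⟶ Z, ∀ j, (ι j).f k ≫ ψ = φ j)
    (hext : ∀ (k : ℤ) (Z : FGProj A) (ψ ψ' : W.X k ⟶ Z),
      (∀ j, (ι j).f k ≫ ψ = (ι j).f k ≫ ψ') → ψ = ψ') :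
    Nonempty (IsColimit (Cofan.mk ((toKProj A).obj W) fun j => (toKProj A).map (ι j))) := by
  have desc (Z : CochainComplex (FGProj A) ℤ) (φ : ∀ j, F j ⟶ Z) :
      ∃ ψ : W ⟶ Z, ∀ j, ι j ≫ ψ = φ j := by
    choose ψ hψ using fun k => hdesc k (Z.X k) fun j => (φ j).f k
    refine ⟨{ f := ψ, comm' := fun k l _ => hext _ _ _ _ fun j => ?_ }, fun j => ?_⟩
    · rw [← Category.assoc, hψ, (φ j).comm, hF, hW, zero_comp, zero_comp, comp_zero]
    · ext k : 1
      exact hψ k j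
  have ext {Z : CochainComplex (FGProj A) ℤ} (ψ ψ' : W ⟶ Z)
      (h : ∀ j, Homotopy (ι j ≫ ψ) (ι j ≫ ψ')) : (toKProj A).map ψ = (toKProj A).map ψ' := by
    -- The homotopies on the summands glue degree by degree through the degreewise universal
    -- property.
    choose s hs using fun k l => hdesc k (Z.X l) fun j => (h j).hom k l
    refine HomotopyCategory.eq_of_homotopy _ _ ⟨s, fun k l hkl => hext _ _ _ _ fun j => ?_,
      fun k => hext _ _ _ _ fun j => ?_⟩
    · rw [hs, (h j).zero _ _ hkl, comp_zero]
    · have hc := (h j).comm k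
      rw [dNext_eq _ (show (ComplexShape.up ℤ).Rel k (k + 1) by simp),
        prevD_eq _ (show (ComplexShape.up ℤ).Rel (k - 1) k by simp), hF, zero_comp, zero_add,
        ← hs, HomologicalComplex.comp_f, HomologicalComplex.comp_f] at hc
      rw [dNext_eq _ (show (ComplexShape.up ℤ).Rel k (k + 1) by simp),
        prevD_eq _ (show (ComplexShape.up ℤ).Rel (k - 1) k by simp), hW, zero_comp, zero_add, hc,
        Preadditive.comp_add, Category.assoc]
  have desc' (T : Cofan fun j => (toKProj A).obj (F j)) : ∃ ψ : (toKProj A).obj W ⟶ T.pt,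
      ∀ j, (toKProj A).map (ι j) ≫ ψ = T.inj j := by
    choose φ hφ using fun j => (toKProj A).map_surjective (X := F j) (Y := T.pt.as) (T.inj j)
    obtain ⟨ψ, hψ⟩ := desc _ φ
    exact ⟨(toKProj A).map ψ, fun j => (((toKProj A).map_comp (ι j) ψ).symm.trans
      (congrArg (toKProj A).map (hψ j))).trans (hφ j)⟩
  have ext' {Z : KProj A} (ψ ψ' : (toKProj A).obj W ⟶ Z)
      (h : ∀ j, (toKProj A).map (ι j) ≫ ψ = (toKProj A).map (ι j) ≫ ψ') : ψ = ψ' := by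
    obtain ⟨φ, rfl⟩ := (toKProj A).map_surjective (X := W) (Y := Z.as) ψ
    obtain ⟨φ', rfl⟩ := (toKProj A).map_surjective (X := W) (Y := Z.as) ψ'
    refine ext φ φ' fun j => HomotopyCategory.homotopyOfEq _ _ ?_
    rw [Functor.map_comp, Functor.map_comp]
    exact h j
  choose d hd using desc'
  exact ⟨Cofan.IsColimit.mk _ d (fun T j => hd T j) fun T m hm =>
    ext' _ _ fun j => (hm j).trans (hd T j).symm⟩

end Coproduct

section AddR

variable {R : Type u} [Ring R]

/-- The complex `R` concentrated in degree `0`. -/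
abbrev regularComplex (R : Type u) [Ring R] : KProj Rᵐᵒᵖ :=
  (toKProj Rᵐᵒᵖ).obj
    ((HomologicalComplex.single (FGProj Rᵐᵒᵖ) (ComplexShape.up ℤ) 0).obj (regularRight R))

/-- The inclusion of finitely generated projective modules in degree `0`. -/
abbrev singleKProj (A : Type u) [Ring A] : FGProj A ⥤ KProj A :=
  HomologicalComplex.single (FGProj A) (ComplexShape.up ℤ) 0 ⋙ toKProj A

/-- The coordinate inclusions of the module of row vectors. -/
def freeRightInj (n : ℕ) (k : Fin n) : regularRight R ⟶ freeRight R n :=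
  ObjectProperty.homMk (ModuleCat.ofHom (LinearMap.single Rᵐᵒᵖ (fun _ => R) k))

/-- The coordinate projections of the module of row vectors. -/
def freeRightProj (n : ℕ) (k : Fin n) : freeRight R n ⟶ regularRight R :=
  ObjectProperty.homMk (ModuleCat.ofHom (LinearMap.proj (R := Rᵐᵒᵖ) (φ := fun _ => R) k))

theorem freeRightInj_proj (n : ℕ) (k : Fin n) :
    freeRightInj (R := R) n k ≫ freeRightProj n k = 𝟙 _ := by
  apply ObjectProperty.hom_ext
  refine ModuleCat.hom_ext (LinearMap.ext fun x => ?_)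
  change (Pi.single k (show R from x) : Fin n → R) k = _
  exact Pi.single_eq_same _ _

theorem freeRightInj_proj_of_ne (n : ℕ) {k l : Fin n} (h : l ≠ k) :
    freeRightInj (R := R) n k ≫ freeRightProj n l = 0 := by
  apply ObjectProperty.hom_ext
  refine ModuleCat.hom_ext (LinearMap.ext fun x => ?_)
  change (Pi.single k (show R from x) : Fin n → R) l = _
  exact Pi.single_eq_of_ne h _

theorem freeRight_sum (n : ℕ) :
    ∑ k, freeRightProj (R := R) n k ≫ freeRightInj n k = 𝟙 _ := by
  apply ObjectProperty.hom_ext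
  refine ModuleCat.hom_ext (LinearMap.ext fun x => ?_)
  have h : (∑ k, freeRightProj (R := R) n k ≫ freeRightInj n k).hom =
      ∑ k, (freeRightProj (R := R) n k ≫ freeRightInj n k).hom :=
    map_sum (ObjectProperty.ι (isFGProj Rᵐᵒᵖ)).mapAddHom _ _
  rw [h, ModuleCat.hom_sum, LinearMap.sum_apply]
  exact Finset.univ_sum_single x

theorem AddR.single_free (n : ℕ) : AddR R ((singleKProj Rᵐᵒᵖ).obj (freeRight R n)) := by
  intro Q hQ _ _ hcop
  have := hcop (ULift (Fin n))
  let G := singleKProj Rᵐᵒᵖ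
  have hc : IsColimit (Cofan.mk (G.obj (freeRight R n))
      fun k : ULift.{u} (Fin n) => G.map (freeRightInj n k.down)) := by
    refine Cofan.IsColimit.mk _ (fun T => ∑ k, G.map (freeRightProj n k) ≫ T.inj ⟨k⟩) ?_ ?_
    · rintro T ⟨k⟩
      change G.map (freeRightInj n k) ≫ _ = _
      rw [Preadditive.comp_sum, Finset.sum_eq_single k]
      · rw [← Category.assoc, ← Functor.map_comp, freeRightInj_proj, G.map_id,
          Category.id_comp]
      · intro l _ hl
        rw [← Category.assoc, ← Functor.map_comp, freeRightInj_proj_of_ne n hl, Functor.map_zero,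
          zero_comp]
      · simp
    · intro T m hm
      have h := G.congr_map (freeRight_sum (R := R) n)
      rw [Functor.map_sum, CategoryTheory.Functor.map_id] at h
      rw [← Category.id_comp m]
      refine (congrArg (fun φ => φ ≫ m) h.symm).trans ?_
      rw [Preadditive.sum_comp]
      refine Finset.sum_congr rfl fun k _ => ?_
      rw [Functor.map_comp, Category.assoc]
      exact congrArg _ (hm ⟨k⟩)
  exact Q.prop_of_isColimit hc fun _ => hQ

theorem AddR.of_retract {X Y : KProj Rᵐᵒᵖ} (r : Retract X Y) (h : AddR R Y) : AddR R X :=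
  fun Q hQ hs hr hc => Q.prop_of_retract r (h Q hQ hs hr hc)

theorem AddR.shift {X : KProj Rᵐᵒᵖ} (h : AddR R X) (n : ℤ) :
    AddR R ((shiftFunctor (KProj Rᵐᵒᵖ) n).obj X) :=
  fun Q hQ hs hr hc => Q.le_shift n _ (h Q hQ hs hr hc)

theorem exists_retract_freeRight (M : FGProj Rᵐᵒᵖ) :
    ∃ n, Nonempty (Retract M (freeRight R n)) := by
  obtain ⟨n, p, s, -, -, hps⟩ := Module.Finite.exists_comp_eq_id_of_projective Rᵐᵒᵖ M.obj
  let e : (Fin n → R) ≃ₗ[Rᵐᵒᵖ] (Fin n → Rᵐᵒᵖ) :=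
    LinearEquiv.piCongrRight fun _ => MulOpposite.opLinearEquiv Rᵐᵒᵖ
  refine ⟨n, ⟨{
    i := ObjectProperty.homMk (ModuleCat.ofHom (e.symm.toLinearMap ∘ₗ s))
    r := ObjectProperty.homMk (ModuleCat.ofHom (p ∘ₗ e.toLinearMap))
    retract := ?_ }⟩⟩
  apply ObjectProperty.hom_ext
  refine ModuleCat.hom_ext (LinearMap.ext fun x => ?_)
  exact (congrArg p (e.apply_symm_apply (s x))).trans (LinearMap.congr_fun hps x)

theorem AddR.single (M : FGProj Rᵐᵒᵖ) : AddR R ((singleKProj Rᵐᵒᵖ).obj M) := by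
  obtain ⟨n, ⟨r⟩⟩ := exists_retract_freeRight M
  exact (AddR.single_free n).of_retract (r.map _)

theorem shift_single_d {A : Type u} [Ring A] (M : FGProj A) (n i j : ℤ) :
    ((shiftFunctor (CochainComplex (FGProj A) ℤ) n).obj
      ((HomologicalComplex.single (FGProj A) (ComplexShape.up ℤ) 0).obj M)).d i j = 0 := by
  rw [CochainComplex.shiftFunctor_obj_d', HomologicalComplex.single_obj_d, smul_zero]
  rfl

/-- The complex `M` concentrated in degree `k`. -/
abbrev shiftedSingle {A : Type u} [Ring A] (M : FGProj A) (k : ℤ) : CochainComplex (FGProj A) ℤ :=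
  (shiftFunctor (CochainComplex (FGProj A) ℤ) (-k)).obj
    ((HomologicalComplex.single (FGProj A) (ComplexShape.up ℤ) 0).obj M)

/-- The only nonzero term of `shiftedSingle M k`. -/
def shiftedSingleIso {A : Type u} [Ring A] (M : FGProj A) (k : ℤ) :
    (shiftedSingle M k).X k ≅ M :=
  HomologicalComplex.singleObjXIsoOfEq (ComplexShape.up ℤ) 0 M (k + -k) (add_neg_cancel k)

theorem isZero_shiftedSingle {A : Type u} [Ring A] (M : FGProj A) {k l : ℤ} (h : k ≠ l) :
    IsZero ((shiftedSingle M k).X l) :=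
  HomologicalComplex.isZero_single_obj_X (ComplexShape.up ℤ) 0 M (l + -k) (by lia)

theorem AddR.shiftedSingle (M : FGProj Rᵐᵒᵖ) (k : ℤ) :
    AddR R ((toKProj Rᵐᵒᵖ).obj (shiftedSingle M k)) :=
  ((AddR.single M).shift (-k)).of_retract
    (.ofIso (((toKProj Rᵐᵒᵖ).commShiftIso (-k)).app _))

/-- Such a complex is the coproduct of its terms placed in their own degrees. Although the family is
infinite, each degree has only one nonzero summand, so this coproduct exists in the homotopy
category. -/
theorem AddR.of_d_eq_zero (W : CochainComplex (FGProj Rᵐᵒᵖ) ℤ) (hW : ∀ i j, W.d i j = 0) :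
    AddR R ((toKProj Rᵐᵒᵖ).obj W) := by
  let F (k : ULift.{u} ℤ) : CochainComplex (FGProj Rᵐᵒᵖ) ℤ :=
    StableComplex.shiftedSingle (W.X k.down) k.down
  have hF : ∀ k i j, (F k).d i j = 0 := fun k i j => shift_single_d _ _ i j
  let ι (k : ULift.{u} ℤ) : F k ⟶ W :=
    { f := fun l => if h : k.down = l then
          eqToHom (by subst h; rfl) ≫ (shiftedSingleIso (W.X l) l).hom
        else 0
      comm' := fun i j _ => by rw [hF, hW, zero_comp, comp_zero] }
  have hι : ∀ k, (ι ⟨k⟩).f k = (shiftedSingleIso (W.X k) k).hom := fun k =>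
    (dif_pos rfl).trans (Category.id_comp _)
  obtain ⟨hc⟩ := nonempty_isColimit_of_degreewise hF hW ι
    (fun k Z φ => ⟨(shiftedSingleIso (W.X k) k).inv ≫ φ ⟨k⟩, by
      rintro ⟨j⟩
      by_cases h : j = k
      · subst h
        rw [hι, Iso.hom_inv_id_assoc]
      · exact (isZero_shiftedSingle _ h).eq_of_src _ _⟩)
    (fun k Z ψ ψ' h => by
      have := h ⟨k⟩
      rwa [hι, cancel_epi] at this)
  intro Q hQ hs hr hcop
  have := hcop (ULift.{u} ℤ)
  exact Q.prop_of_isColimit hc fun ⟨k⟩ => AddR.shiftedSingle _ _ Q hQ hs hr hcop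

end AddR

/-! ### Objects of `Add R` as retracts of complexes with zero differential -/

section Gorenstein

variable {R : Type u} [Ring R]

/-- The objects `X` such that a morphism from `X` vanishes as soon as its composites with all
morphisms from shifts of `R` to `X` do. -/
def ghostProjective (R : Type u) [Ring R] : ObjectProperty (KProj Rᵐᵒᵖ) := fun X =>
  ∀ ⦃Y : KProj Rᵐᵒᵖ⦄ (f : X ⟶ Y),
    (∀ (n : ℤ) (v : (shiftFunctor (KProj Rᵐᵒᵖ) n).obj (regularComplex R) ⟶ X), v ≫ f = 0) → f = 0

theorem ghostProjective_regularComplex : ghostProjective R (regularComplex R) := by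
  intro Y f hf
  have := hf 0 ((shiftFunctorZero (KProj Rᵐᵒᵖ) ℤ).hom.app _)
  rwa [← comp_zero (f := (shiftFunctorZero (KProj Rᵐᵒᵖ) ℤ).hom.app (regularComplex R)),
    cancel_epi] at this

theorem ghostProjective_shift {X : KProj Rᵐᵒᵖ} (hX : ghostProjective R X) (a : ℤ) :
    ghostProjective R ((shiftFunctor (KProj Rᵐᵒᵖ) a).obj X) := by
  intro Y f hf
  let e := shiftFunctorCompIsoId (KProj Rᵐᵒᵖ) a (-a) (add_neg_cancel a)
  apply (shiftFunctor (KProj Rᵐᵒᵖ) (-a)).map_injective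
  rw [Functor.map_zero, ← cancel_epi (e.inv.app X), comp_zero]
  apply hX
  intro n v
  have h := hf (n + a) ((shiftFunctorAdd (KProj Rᵐᵒᵖ) n a).hom.app _ ≫
    (shiftFunctor (KProj Rᵐᵒᵖ) a).map v)
  rw [Category.assoc, ← comp_zero (f := (shiftFunctorAdd (KProj Rᵐᵒᵖ) n a).hom.app _),
    cancel_epi] at h
  have nat := e.inv.naturality v
  dsimp only [Functor.id_map, Functor.comp_map] at nat
  rw [← Category.assoc]
  refine (congrArg (fun φ => φ ≫ (shiftFunctor (KProj Rᵐᵒᵖ) (-a)).map f) nat).trans ?_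
  rw [Category.assoc, ← Functor.map_comp, h, Functor.map_zero, comp_zero]

/-- The detection property holds for `R` and is inherited by shifts, retracts and arbitrary
colimits. This avoids any explicit description of the coproducts that exist in `KProj Rᵐᵒᵖ`. -/
theorem ghostProjective_of_addR {X : KProj Rᵐᵒᵖ} (hX : AddR R X) : ghostProjective R X := by
  refine hX _ ghostProjective_regularComplex ⟨fun a => ⟨fun X hX => ghostProjective_shift hX a⟩⟩
    ⟨fun {X Y} r hY Z f hf => ?_⟩ fun J => ⟨fun X ⟨p⟩ Y f hf => ?_⟩
  · have : r.r ≫ f = 0 := hY _ fun n v => by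
      rw [← Category.assoc]
      exact hf n _
    rw [← Category.id_comp f, ← r.retract, Category.assoc, this, comp_zero]
  · refine p.isColimit.hom_ext fun j => ?_
    rw [comp_zero]
    refine p.prop_diag_obj j _ fun n v => ?_
    rw [← Category.assoc]
    exact hf n _

/-- Every map from a shift of `R` to `X` factors through the cocycle cover `p`, so the map `g` from
`X` to the cone of `p` kills all of them. By `ghostProjective_of_addR` it is zero, and then `p`
splits. -/
theorem exists_retract_zeroDiff [IsNoetherianRing Rᵐᵒᵖ] {X : KProj Rᵐᵒᵖ} (hX : AddR R X) :
    ∃ M : ℤ → FGProj Rᵐᵒᵖ, Nonempty (Retract X ((toKProj Rᵐᵒᵖ).obj (zeroDiff M))) := by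
  obtain ⟨M, π, hπ⟩ := exists_zeroDiff_cover X.as
  let p : (toKProj Rᵐᵒᵖ).obj (zeroDiff M) ⟶ X := (toKProj Rᵐᵒᵖ).map π
  obtain ⟨Z, g, h, hT⟩ := distinguished_cocone_triangle p
  have hg : g = 0 := by
    refine ghostProjective_of_addR hX g fun n v => ?_
    let e := ((toKProj Rᵐᵒᵖ).commShiftIso n).app
      ((HomologicalComplex.single (FGProj Rᵐᵒᵖ) (ComplexShape.up ℤ) 0).obj (regularRight R))
    obtain ⟨v', hv'⟩ := (toKProj Rᵐᵒᵖ).map_surjective (Y := X.as) (e.hom ≫ v)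
    obtain ⟨w, rfl⟩ := exists_lift_of_cyclesSurj (shift_single_d _ n) π hπ v'
    rw [Functor.map_comp] at hv'
    have hpg : p ≫ g = 0 := comp_distTriang_mor_zero₁₂ _ hT
    rw [← cancel_epi e.hom, comp_zero]
    refine ((Category.assoc _ _ _).symm.trans (congrArg (fun φ => φ ≫ g) hv'.symm)).trans ?_
    exact (Category.assoc _ _ _).trans ((congrArg _ hpg).trans comp_zero)
  obtain ⟨s, hs⟩ := Triangle.coyoneda_exact₂ _ hT (𝟙 X) (by
    rw [Triangle.mk_mor₂, hg]
    exact comp_zero)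
  exact ⟨M, ⟨⟨s, p, hs.symm⟩⟩⟩

theorem isGorensteinProjective_of_addR [IsNoetherianRing Rᵐᵒᵖ] {X : KProj Rᵐᵒᵖ}
    (hX : AddR R X) : IsGorensteinProjective X := by
  obtain ⟨M, ⟨r⟩⟩ := exists_retract_zeroDiff hX
  exact (isGorensteinProjective_zeroDiff M).of_retract r

end Gorenstein

/-! ### Resolutions by split complexes -/

section Resolution

variable {R : Type u} [Ring R]

/-- `X` is the third term and `Y` the first term of a triangle with middle term in `Add R` such
that the triangle and its dual are cohomologically ghost. -/
def IsSplitSyzygy (Y X : KProj Rᵐᵒᵖ) : Prop :=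
  ∃ (P : KProj Rᵐᵒᵖ) (f : Y ⟶ P) (g : P ⟶ X) (h : X ⟶ (shiftFunctor (KProj Rᵐᵒᵖ) (1 : ℤ)).obj Y),
    AddR R P ∧ IsCohGhost (Triangle.mk f g h) ∧ IsCohShortExact (dualMap g) (dualMap f)

theorem exists_isSplitSyzygy_left [IsNoetherianRing Rᵐᵒᵖ] {X : KProj Rᵐᵒᵖ}
    (hX : IsGorensteinProjective X) : ∃ Y, IsGorensteinProjective Y ∧ IsSplitSyzygy Y X := by
  obtain ⟨M, π, hπ⟩ := exists_zeroDiff_cover X.as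
  let g : (toKProj Rᵐᵒᵖ).obj (zeroDiff M) ⟶ X := (toKProj Rᵐᵒᵖ).map π
  obtain ⟨Y, f, h, hT⟩ := distinguished_cocone_triangle₁ g
  obtain ⟨h₁, h₂, h₃⟩ :=
    IsGorensteinProjective.first hT hπ.epi_cohomology_map (isGorensteinProjective_zeroDiff M) hX
  exact ⟨Y, h₃, _, f, g, h, AddR.of_d_eq_zero _ fun _ _ => rfl, ⟨hT, h₁⟩, h₂⟩

theorem exists_isSplitSyzygy_right [IsNoetherianRing R] {X : KProj Rᵐᵒᵖ}
    (hX : IsGorensteinProjective X) : ∃ Z, IsGorensteinProjective Z ∧ IsSplitSyzygy X Z := by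
  obtain ⟨M, ι, hι⟩ := exists_zeroDiff_hull X.as
  let f : X ⟶ (toKProj Rᵐᵒᵖ).obj (zeroDiff M) := (toKProj Rᵐᵒᵖ).map ι
  obtain ⟨Z, g, h, hT⟩ := distinguished_cocone_triangle f
  obtain ⟨h₁, h₂, h₃⟩ :=
    IsGorensteinProjective.third hT hι.epi_cohomology_map hX (isGorensteinProjective_zeroDiff M)
  exact ⟨Z, h₃, _, f, g, h, AddR.of_d_eq_zero _ fun _ _ => rfl, ⟨hT, h₁⟩, h₂⟩

/-- A relation which is total in both directions admits two-sided chains through any point. -/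
theorem exists_int_chain {T : Type*} {r : T → T → Prop} (h₁ : ∀ x, ∃ y, r y x)
    (h₂ : ∀ x, ∃ y, r x y) (x : T) : ∃ Y : ℤ → T, Y 0 = x ∧ ∀ t, r (Y (t + 1)) (Y t) := by
  choose d hd using h₁
  choose e he using h₂
  refine ⟨fun t => match t with
    | Int.ofNat n => d^[n] x
    | Int.negSucc n => e^[n + 1] x, rfl, fun t => ?_⟩
  match t with
  | Int.ofNat n =>
    change r (d^[n + 1] x) (d^[n] x)
    rw [Function.iterate_succ_apply']
    exact hd _
  | Int.negSucc 0 => exact he x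
  | Int.negSucc (n + 1) =>
    change r (e^[n + 1] x) (e^[n + 2] x)
    rw [Function.iterate_succ_apply' e (n + 1)]
    exact he _

theorem exists_split_resolution [IsNoetherianRing R] [IsNoetherianRing Rᵐᵒᵖ] {X : KProj Rᵐᵒᵖ}
    (hX : IsGorensteinProjective X) :
    ∃ Y : ℤ → KProj Rᵐᵒᵖ, Y 0 = X ∧ ∀ t, IsSplitSyzygy (Y (t + 1)) (Y t) := by
  -- The chain is built among Gorenstein projective objects, where a further syzygy exists in either
  -- direction.
  obtain ⟨Y, hY, h⟩ := exists_int_chain (T := { X : KProj Rᵐᵒᵖ // IsGorensteinProjective X })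
    (r := fun Y X => IsSplitSyzygy Y.1 X.1)
    (fun X => by
      obtain ⟨Y, hY, h⟩ := exists_isSplitSyzygy_left X.2
      exact ⟨⟨Y, hY⟩, h⟩)
    (fun X => by
      obtain ⟨Y, hY, h⟩ := exists_isSplitSyzygy_right X.2
      exact ⟨⟨Y, hY⟩, h⟩) ⟨X, hX⟩
  exact ⟨fun t => (Y t).1, congrArg Subtype.val hY, h⟩

end Resolution

end StableComplex

end

theorem theorem5p11 {R : Type u} [Ring R] [IsNoetherianRing R] [IsNoetherianRing Rᵐᵒᵖ]
    (X : StableComplex.KProj Rᵐᵒᵖ) :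
    List.TFAE
      [StableComplex.IsGorensteinProjective X,
        ∃ (Y P : ℤ → StableComplex.KProj Rᵐᵒᵖ) (f : ∀ t, Y (t + 1) ⟶ P t) (g : ∀ t, P t ⟶ Y t)
          (h : ∀ t, Y t ⟶ (shiftFunctor (StableComplex.KProj Rᵐᵒᵖ) (1 : ℤ)).obj (Y (t + 1))),
          Nonempty (X ≅ Y 0) ∧
          ∀ t, StableComplex.AddR R (P t) ∧
            StableComplex.IsCohGhost (Triangle.mk (f t) (g t) (h t)) ∧
            StableComplex.IsCohShortExact (StableComplex.dualMap (g t))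
              (StableComplex.dualMap (f t)),
        ∃ (Y G : ℤ → StableComplex.KProj Rᵐᵒᵖ) (f : ∀ t, Y (t + 1) ⟶ G t) (g : ∀ t, G t ⟶ Y t)
          (h : ∀ t, Y t ⟶ (shiftFunctor (StableComplex.KProj Rᵐᵒᵖ) (1 : ℤ)).obj (Y (t + 1))),
          Nonempty (X ≅ Y 0) ∧
          ∀ t, StableComplex.IsGorensteinProjective (G t) ∧
            StableComplex.IsCohGhost (Triangle.mk (f t) (g t) (h t)) ∧
            StableComplex.IsCohShortExact (StableComplex.dualMap (g t))
              (StableComplex.dualMap (f t))] := by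
  tfae_have 1 → 2 := by
    intro hX
    obtain ⟨Y, rfl, hY⟩ := StableComplex.exists_split_resolution hX
    choose P f g h H using hY
    exact ⟨Y, P, f, g, h, ⟨Iso.refl _⟩, H⟩
  tfae_have 2 → 3 := by
    rintro ⟨Y, P, f, g, h, e, H⟩
    exact ⟨Y, P, f, g, h, e,
      fun t => ⟨StableComplex.isGorensteinProjective_of_addR (H t).1, (H t).2⟩⟩
  tfae_have 3 → 1 := by
    rintro ⟨Y, G, f, g, h, ⟨e⟩, H⟩
    exact (StableComplex.isGorensteinProjective_of_resolution H 0).of_iso e.symm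
  tfae_finish
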